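/- **Setting.** Let $p$ be a probability distribution over tasks $i\in\mathcal I$ with loss functions $f_i:\mathbb R^d\to\mathbb R$, let $\alpha>0$, and let $$F(w)=\mathbb E_{i\sim p}\big[f_i(w-\alpha\nabla f_i(w))\big]$$ be the MAML objective. For a data point $\theta$ of task $i$ let $\nabla f_i(w,\theta)$ and $\nabla^2 f_i(w,\theta)$ be unbiased stochastic estimates of $\nabla f_i(w)$ and $\nabla^2 f_i(w)$; for a dataset $\mathcal D$ write $\tilde\nabla f_i(w,\mathcal D)$ and $\tilde\nabla^2 f_i(w,\mathcal D)$ for the averages over $\theta\in\mathcal D$. **Assumptions.** 1. $F$ is bounded below; $\Delta:=F(w_0)-\inf_w F(w)$. 2. Every $f_i$ is twice continuously differentiable, $\nabla f_i$ is $L$-Lipschitz ($L>0$) and $\nabla^2 f_i$ is $\rho$-Lipschitz in operator norm. 3. $\mathbb E_{i\sim p}\|\nabla f_i(w)-\mathbb E_{j\sim p}\nabla f_j(w)\|^2\le\sigma^2$ for all $w$, where $\sigma>0$. 4. $\mathbb E_\theta\|\nabla f_i(w,\theta)-\nabla f_i(w)\|^2\le\tilde\sigma^2$ and $\mathbb E_\theta\|\nabla^2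 f_i(w,\theta)-\nabla^2 f_i(w)\|^2\le\sigma_H^2$ for all $i,w$, where $\tilde\sigma,\sigma_H\ge0$. 5. $\rho\alpha/L\le c_1$ and $\sigma^2+\tilde\sigma^2\le c_2$ for constants $c_1,c_2$. **Algorithm (MAML).** Start at a deterministic $w_0$. At iteration $k$ draw $B$ i.i.d. tasks $\mathcal B_k$ from $p$ and, for each of them, independent datasets $\mathcal D_{in}^i,\mathcal D_o^i,\mathcal D_h^i$ of $D_{in},D_o,D_h\ge1$ i.i.d. data points of the task; independently draw $B'\ge1$ i.i.d. tasks $\mathcal B'_k$ from $p$, each with a dataset $\mathcal D_\beta^j$ of $D_\beta\ge1$ i.i.d. data points; draws of different iterations are independent. Set $$w_{k+1}=w_k-\frac{\beta_k}{B}\sum_{i\in\mathcal B_k}\big(I-\alpha\tilde\nabla^2 f_i(w_k,\mathcal D_h^i)\big)\tilde\nabla f_i\big(w_k-\alpha\tilde\nabla f_i(w_k,\mathcal D_{in}^i),\mathcal D_o^i\big),$$ $$\beta_k=\frac1{12}\cdot\frac{1}{4L+\frac{2\rho\alpha}{B'}\sum_{j\in\mathcal B'_k}\|\tilde\nabla f_j(w_k,\mathcal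 D_\beta^j)\|}.$$ **Corollary.** For all $c_1,c_2$ there are positive constants $C_1,C_2,C$, depending only on $c_1,c_2$, such that the following holds under the assumptions above. Let $\alpha\in(0,\frac1{6L}]$, $0<\epsilon<1$, $B\ge20$, $D_h\ge\lceil2\alpha^2\sigma_H^2\rceil$, $B'\ge\lceil\tfrac12(\rho\alpha\sigma/L)^2\rceil$, $D_\beta\ge\lceil(2\rho\alpha\tilde\sigma/L)^2\rceil$, and $$B\ge\frac{C_1\sigma^2}{\epsilon^2},\qquad D_{in}\ge\frac{C_2\tilde\sigma^2}{\epsilon^2},\qquad BD_o\ge\frac{C_2\tilde\sigma^2}{\epsilon^2}.$$ Then $F$ is differentiable, and MAML finds an $\epsilon$-first-order stationary point of $F$ within $\Delta\cdot O(L/\epsilon^2)$ iterations: there is an iterate $w_k$ with $k\le C\,\Delta\,L/\epsilon^2$ and $\mathbb E\|\nabla F(w_k)\|\le\epsilon$. -/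

import Mathlib

open MeasureTheory ProbabilityTheory
open scoped ENNReal

noncomputable section

namespace MAML

/-- The parameter space `ℝ^d` with its Euclidean norm. -/
abbrev Vec (d : ℕ) : Type := EuclideanSpace ℝ (Fin d)

/-- The Hessian of `f` at `w`, as a linear operator: the derivative of the gradient field. -/
def hessian {d : ℕ} (f : Vec d → ℝ) (w : Vec d) : Vec d →L[ℝ] Vec d :=
  fderiv ℝ (fun u => gradient f u) w

/-- A meta-learning problem: a distribution `p` over tasks `i : ι`, for each task a
distribution `data i` of data points `θ : Θ`, a loss `f i`, and the per-sample stochastic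
gradients `∇ f_i(w, θ)` and stochastic Hessians `∇² f_i(w, θ)`. -/
structure Problem (d : ℕ) (ι Θ : Type*) [MeasurableSpace ι] [MeasurableSpace Θ] where
  p : Measure ι
  [prob_p : IsProbabilityMeasure p]
  data : Kernel ι Θ
  [markov_data : IsMarkovKernel data]
  f : ι → Vec d → ℝ
  sgrad : ι → Vec d → Θ → Vec d
  shess : ι → Vec d → Θ → (Vec d →L[ℝ] Vec d)

attribute [instance] Problem.prob_p Problem.markov_data

/-- The batch sizes used by MAML: the number `B` of tasks of the meta update, the dataset sizes
`Din`, `Do`, `Dh` for each of these tasks, the number `B'` of tasks used for the stepsize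
and the dataset size `Dβ` for each of those. -/
structure BatchSizes where
  B : ℕ
  Din : ℕ
  Do : ℕ
  Dh : ℕ
  B' : ℕ
  Dβ : ℕ

/-- The law of a dataset of `n` independent data points of task `i`, as a function of `i`. -/
def datasetKernel {ι Θ : Type*} [MeasurableSpace ι] [MeasurableSpace Θ]
    (κ : Kernel ι Θ) [IsMarkovKernel κ] (n : ℕ) : Kernel ι (Fin n → Θ) where
  toFun i := Measure.pi fun _ => κ i
  measurable' := by
    refine Measurable.measure_of_isPiSystem_of_isProbabilityMeasure
      generateFrom_pi.symm isPiSystem_pi ?_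
    rintro _ ⟨s, hs, rfl⟩
    simp only [Measure.pi_pi]
    refine Finset.measurable_prod _ fun j _ => ?_
    exact Kernel.measurable_coe κ (hs j (Set.mem_univ j))

/-- The random draw for one task of the batch of the meta update: the task and its three
datasets `D_in`, `D_o`, `D_h`. -/
abbrev OuterDraw (ι Θ : Type*) (s : BatchSizes) : Type _ :=
  ι × (Fin s.Din → Θ) × (Fin s.Do → Θ) × (Fin s.Dh → Θ)

/-- The random draw for one task of the batch of the stepsize: the task and its dataset. -/
abbrev StepsizeDraw (ι Θ : Type*) (s : BatchSizes) : Type _ :=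
  ι × (Fin s.Dβ → Θ)

/-- Everything that is drawn in one iteration of MAML. -/
abbrev IterDraw (ι Θ : Type*) (s : BatchSizes) : Type _ :=
  (Fin s.B → OuterDraw ι Θ s) × (Fin s.B' → StepsizeDraw ι Θ s)

namespace Problem

variable {d : ℕ} {ι Θ : Type*} [MeasurableSpace ι] [MeasurableSpace Θ]

/-- The MAML objective `F(w) = E_{i ∼ p} [f_i (w - α ∇ f_i(w))]`. -/
def metaLoss (P : Problem d ι Θ) (α : ℝ) (w : Vec d) : ℝ :=
  ∫ i, P.f i (w - α • gradient (P.f i) w) ∂P.p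

/-- The expected gradient `E_{i ∼ p} [∇ f_i(w)]`. -/
def meanGrad (P : Problem d ι Θ) (w : Vec d) : Vec d :=
  ∫ i, gradient (P.f i) w ∂P.p

/-- The stochastic gradient of task `i` at `w` on the dataset `D`. -/
def batchGrad (P : Problem d ι Θ) (i : ι) (w : Vec d) {n : ℕ} (D : Fin n → Θ) : Vec d :=
  (n : ℝ)⁻¹ • ∑ j, P.sgrad i w (D j)

/-- The stochastic Hessian of task `i` at `w` on the dataset `D`. -/
def batchHess (P : Problem d ι Θ) (i : ι) (w : Vec d) {n : ℕ} (D : Fin n → Θ) :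
    Vec d →L[ℝ] Vec d :=
  (n : ℝ)⁻¹ • ∑ j, P.shess i w (D j)

/-- Law of an `OuterDraw`: the task has law `p` and, given the task, the three datasets are
independent and consist of independent data points of the task. -/
def outerLaw (P : Problem d ι Θ) (s : BatchSizes) : Measure (OuterDraw ι Θ s) :=
  P.p ⊗ₘ (datasetKernel P.data s.Din ×ₖ (datasetKernel P.data s.Do ×ₖ datasetKernel P.data s.Dh))

/-- Law of a `StepsizeDraw`. -/
def stepsizeLaw (P : Problem d ι Θ) (s : BatchSizes) : Measure (StepsizeDraw ι Θ s) :=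
  P.p ⊗ₘ datasetKernel P.data s.Dβ

/-- Law of an `IterDraw`: the `B` outer draws and the `B'` stepsize draws are independent. -/
def iterLaw (P : Problem d ι Θ) (s : BatchSizes) : Measure (IterDraw ι Θ s) :=
  (Measure.pi fun _ : Fin s.B => P.outerLaw s).prod
    (Measure.pi fun _ : Fin s.B' => P.stepsizeLaw s)

/-- The stochastic stepsize parameter
`β̃(w) = 1 / (4 L + (2 ρ α / B') ∑_{j ∈ B'} ‖∇̃ f_j(w, D_β^j)‖)`. -/
def betaTilde (P : Problem d ι Θ) (s : BatchSizes) (L ρ α : ℝ) (w : Vec d)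
    (x : Fin s.B' → StepsizeDraw ι Θ s) : ℝ :=
  1 / (4 * L + 2 * ρ * α / s.B' * ∑ j, ‖P.batchGrad (x j).1 w (x j).2‖)

/-- The contribution
`(I - α ∇̃² f_i(w, D_h)) ∇̃ f_i(w - α ∇̃ f_i(w, D_in), D_o)` of one task to the MAML direction. -/
def taskDirection (P : Problem d ι Θ) {s : BatchSizes} (α : ℝ) (w : Vec d)
    (x : OuterDraw ι Θ s) : Vec d :=
  let i := x.1
  let Din := x.2.1
  let Do := x.2.2.1
  let Dh := x.2.2.2
  let v := P.batchGrad i (w - α • P.batchGrad i w Din) Do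
  v - α • P.batchHess i w Dh v

/-- One MAML step from `w`, with stepsize `β_k = β̃(w) / 12`. -/
def step (P : Problem d ι Θ) (s : BatchSizes) (L ρ α : ℝ) (w : Vec d)
    (x : IterDraw ι Θ s) : Vec d :=
  w - ((P.betaTilde s L ρ α w x.2 / 12) / s.B) • ∑ b, P.taskDirection α w (x.1 b)

/-- The MAML iterates `w_0, w_1, …` started at `w₀`; iteration `k` uses the draw `x k`. -/
def iterates (P : Problem d ι Θ) (s : BatchSizes) (L ρ α : ℝ) (w₀ : Vec d)
    (x : ℕ → IterDraw ι Θ s) : ℕ → Vec d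
  | 0 => w₀
  | k + 1 => P.step s L ρ α (P.iterates s L ρ α w₀ x k) (x k)

/-- The assumptions on the problem.  Variance bounds are stated with the Lebesgue integral in
`[0, ∞]`, so that they include the finiteness of the second moments. -/
structure Assumptions (P : Problem d ι Θ) (L ρ α σ σt σH : ℝ) : Prop where
  measurable_f : ∀ w, Measurable fun i => P.f i w
  measurable_sgrad : Measurable fun x : ι × Vec d × Θ => P.sgrad x.1 x.2.1 x.2.2
  measurable_shess : Measurable fun x : ι × Vec d × Θ => P.shess x.1 x.2.1 x.2.2
  /-- the expected loss is well defined -/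
  integrable_f : ∀ w, Integrable (fun i => P.f i w) P.p
  /-- the MAML objective is bounded below -/
  bddBelow : BddBelow (Set.range (P.metaLoss α))
  contDiff : ∀ i, ContDiff ℝ 2 (P.f i)
  grad_lipschitz : ∀ i w u, ‖gradient (P.f i) w - gradient (P.f i) u‖ ≤ L * ‖w - u‖
  hess_lipschitz : ∀ i w u, ‖hessian (P.f i) w - hessian (P.f i) u‖ ≤ ρ * ‖w - u‖
  /-- bounded variance over the tasks -/
  task_variance : ∀ w,
    ∫⁻ i, ‖P.meanGrad w - gradient (P.f i) w‖ₑ ^ 2 ∂P.p ≤ ENNReal.ofReal (σ ^ 2)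
  sgrad_unbiased : ∀ i w, ∫ θ, P.sgrad i w θ ∂P.data i = gradient (P.f i) w
  shess_unbiased : ∀ i w, ∫ θ, P.shess i w θ ∂P.data i = hessian (P.f i) w
  sgrad_variance : ∀ i w,
    ∫⁻ θ, ‖P.sgrad i w θ - gradient (P.f i) w‖ₑ ^ 2 ∂P.data i ≤ ENNReal.ofReal (σt ^ 2)
  shess_variance : ∀ i w,
    ∫⁻ θ, ‖P.shess i w θ - hessian (P.f i) w‖ₑ ^ 2 ∂P.data i ≤ ENNReal.ofReal (σH ^ 2)

end Problem

/-- A random vector `W` is an `ε`-approximate first-order stationary point of the differentiable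
function `F` if `E ‖∇F(W)‖ ≤ ε`. -/
def IsApproxFOSP {d : ℕ} {Ω : Type*} [MeasurableSpace Ω] (μ : Measure Ω)
    (F : Vec d → ℝ) (ε : ℝ) (W : Ω → Vec d) : Prop :=
  Differentiable ℝ F ∧ AEMeasurable W μ ∧
    Integrable (fun ω => ‖gradient F (W ω)‖) μ ∧ ∫ ω, ‖gradient F (W ω)‖ ∂μ ≤ ε

end MAML

end

noncomputable section

namespace MAML

/-! ### Second moments: fibrewise bounds, bias-variance decomposition, averages of independent
samples. -/

section Probability

variable {α β E : Type*} [MeasurableSpace α] [MeasurableSpace β] [NormedAddCommGroup E]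

/-! The gradient of F at w is the mean G(w) of the gradients of the adapted losses
(`hasGradientAt_metaLoss`). G need not be globally Lipschitz, but based at w it is Lipschitz with
constant 7/12 · S(w), where S(w) = 4L + 2ρα E‖∇f_i(w)‖ (`norm_metaGrad_sub_le`). A constant attached
to the base point alone is enough for the quadratic upper bound of F around w (`metaLoss_le`).

The stepsize is an estimate of 1/(12 S(w)), drawn independently of the update direction, so in the
expected upper bound its moments separate from those of the direction. Its mean is at least of order
1/S and its second moment at most of order 1/S² (`betaTilde_moments`, by way of
`reciprocal_moments`). The direction has mean G up to a bias caused by the inner sampling, and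
second moment at most 33/10 ‖G‖² plus noise (`memLp_average_taskDirection`). Hence one step lowers
the expected value of F by at least (‖G‖²/100 − N/5)/S, where N bounds the sampling noise
(`integral_metaLoss_step_le`).

Since S itself may grow with the gradient, S ≤ A L (1 + ‖G‖), the gain is only of order ‖G‖²/(1 +
‖G‖). For ε ≤ 1 this dominates an affine function of ‖G‖ with slope of order ε
(`integral_metaLoss_step_le_linear`). The drift is therefore linear in ‖G‖ and can be averaged over
the random iterate. While E‖G‖ > ε, the expectation of F − inf F drops by more than ε²/(400 A L) per
iteration, and being nonnegative it can do so only about 400 A L Δ/ε² times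
(`exists_integral_le_of_drift`). -/

lemma lintegral_enorm_sq_eq {μ : Measure α} {f : α → E} (hf : MemLp f 2 μ) :
    ∫⁻ x, ‖f x‖ₑ ^ 2 ∂μ = ENNReal.ofReal (∫ x, ‖f x‖ ^ 2 ∂μ) := by
  rw [ofReal_integral_eq_lintegral_ofReal (hf.integrable_norm_pow two_ne_zero)
    (Filter.Eventually.of_forall fun x => by positivity)]
  refine lintegral_congr fun x => ?_
  rw [ENNReal.ofReal_pow (norm_nonneg _), ofReal_norm]

lemma memLp_two_of_lintegral_le {μ : Measure α} {f : α → E} {c : ℝ}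
    (hf : AEStronglyMeasurable f μ) (hc : 0 ≤ c)
    (h : ∫⁻ x, ‖f x‖ₑ ^ 2 ∂μ ≤ ENNReal.ofReal c) :
    MemLp f 2 μ ∧ ∫ x, ‖f x‖ ^ 2 ∂μ ≤ c := by
  have hm : MemLp f 2 μ := by
    refine ⟨hf, ?_⟩
    rw [eLpNorm_lt_top_iff_lintegral_rpow_enorm_lt_top two_ne_zero ENNReal.ofNat_ne_top]
    simpa using h.trans_lt ENNReal.ofReal_lt_top
  refine ⟨hm, ?_⟩
  rw [lintegral_enorm_sq_eq hm] at h
  exact (ENNReal.ofReal_le_ofReal_iff hc).1 h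

lemma sq_integral_norm_le {μ : Measure α} [IsProbabilityMeasure μ] {f : α → E}
    (hf : MemLp f 2 μ) : (∫ x, ‖f x‖ ∂μ) ^ 2 ≤ ∫ x, ‖f x‖ ^ 2 ∂μ := by
  have h1 := hf.integrable one_le_two |>.norm
  have h2 := hf.integrable_norm_pow two_ne_zero
  set m := ∫ x, ‖f x‖ ∂μ
  have : 0 ≤ ∫ x, (‖f x‖ - m) ^ 2 ∂μ := integral_nonneg fun x => sq_nonneg _
  have e : ∫ x, (‖f x‖ - m) ^ 2 ∂μ = ∫ x, ‖f x‖ ^ 2 ∂μ - m ^ 2 := by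
    calc _ = ∫ x, (‖f x‖ ^ 2 - (2 * m) * ‖f x‖ + m ^ 2) ∂μ := by
          congr 1; ext x; ring
      _ = _ := by
          have h3 : Integrable (fun x => 2 * m * ‖f x‖) μ := h1.const_mul _
          have h4 : Integrable (fun x => ‖f x‖ ^ 2 - 2 * m * ‖f x‖) μ := h2.sub h3
          rw [integral_add h4 (integrable_const _), integral_sub h2 h3, integral_const_mul]
          simp only [integral_const, probReal_univ, one_smul]
          change _ - 2 * m * m + _ = _
          ring
  linarith

lemma integral_norm_le_of_sq_le {μ : Measure α} [IsProbabilityMeasure μ] {f : α → E} {c : ℝ}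
    (hf : MemLp f 2 μ) (hc : 0 ≤ c) (h : ∫ x, ‖f x‖ ^ 2 ∂μ ≤ c ^ 2) : ∫ x, ‖f x‖ ∂μ ≤ c :=
  abs_le_of_sq_le_sq' ((sq_integral_norm_le hf).trans h) hc |>.2

/-- Square integrability on a composition product, from bounds along the fibres. -/
lemma memLp_compProd {μ : Measure α} [IsProbabilityMeasure μ] {κ : Kernel α β} [IsMarkovKernel κ]
    {f : α × β → E} {u : α → ℝ} [MeasurableSpace E] [BorelSpace E] [SecondCountableTopology E]
    (hf : Measurable f)
    (h : ∀ a, MemLp (fun b => f (a, b)) 2 (κ a))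
    (hu : ∀ a, ∫ b, ‖f (a, b)‖ ^ 2 ∂κ a ≤ u a) (hui : Integrable u μ) :
    MemLp f 2 (μ ⊗ₘ κ) ∧ ∫ x, ‖f x‖ ^ 2 ∂(μ ⊗ₘ κ) ≤ ∫ a, u a ∂μ := by
  have h0 : ∀ a, 0 ≤ u a := fun a => (integral_nonneg fun b => by positivity).trans (hu a)
  refine memLp_two_of_lintegral_le hf.aestronglyMeasurable (integral_nonneg h0) ?_
  rw [Measure.lintegral_compProd (by fun_prop),
    ofReal_integral_eq_lintegral_ofReal hui (Filter.Eventually.of_forall h0)]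
  refine lintegral_mono fun a => ?_
  rw [lintegral_enorm_sq_eq (h a)]
  exact ENNReal.ofReal_le_ofReal (hu a)

lemma memLp_prod {μ : Measure α} [IsProbabilityMeasure μ] {ν : Measure β} [IsProbabilityMeasure ν]
    {f : α × β → E} {u : α → ℝ} [MeasurableSpace E] [BorelSpace E] [SecondCountableTopology E]
    (hf : Measurable f)
    (h : ∀ a, MemLp (fun b => f (a, b)) 2 ν)
    (hu : ∀ a, ∫ b, ‖f (a, b)‖ ^ 2 ∂ν ≤ u a) (hui : Integrable u μ) :
    MemLp f 2 (μ.prod ν) ∧ ∫ x, ‖f x‖ ^ 2 ∂(μ.prod ν) ≤ ∫ a, u a ∂μ := by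
  have := memLp_compProd (μ := μ) (κ := Kernel.const α ν) hf (by simpa using h)
    (by simpa using hu) hui
  rwa [Measure.compProd_const] at this

variable [InnerProductSpace ℝ E]

lemma integrable_inner_of_memLp {μ : Measure α} {f g : α → E} (hf : MemLp f 2 μ)
    (hg : MemLp g 2 μ) : Integrable (fun x => inner ℝ (f x) (g x)) μ := by
  refine (hf.norm.integrable_mul hg.norm).mono'
    (hf.aestronglyMeasurable.inner hg.aestronglyMeasurable)
    (Filter.Eventually.of_forall fun x => ?_)
  exact norm_inner_le_norm (f x) (g x)

lemma memLp_average {μ : Measure α} [IsProbabilityMeasure μ] {f : α → E} (hf : MemLp f 2 μ)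
    (n : ℕ) :
    MemLp (fun x : Fin n → α => (n : ℝ)⁻¹ • ∑ j, f (x j)) 2 (Measure.pi fun _ => μ) := by
  have h := memLp_finsetSum (μ := Measure.pi fun _ : Fin n => μ) (p := 2) Finset.univ
    (f := fun j (x : Fin n → α) => f (x j)) fun j _ => ?_
  · exact h.const_smul (n : ℝ)⁻¹
  exact hf.comp_measurePreserving (measurePreserving_eval (fun _ : Fin n => μ) j)

lemma integral_average {μ : Measure α} [IsProbabilityMeasure μ] {f : α → E} (hf : Integrable f μ)
    {n : ℕ} (hn : 1 ≤ n) :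
    ∫ x : Fin n → α, (n : ℝ)⁻¹ • ∑ j, f (x j) ∂(Measure.pi fun _ => μ) = ∫ a, f a ∂μ := by
  have : (n : ℝ) ≠ 0 := by positivity
  rw [integral_smul, integral_finsetSum]
  · simp_rw [integral_comp_eval (μ := fun _ : Fin n => μ) hf.aestronglyMeasurable]
    rw [Finset.sum_const, Finset.card_univ, Fintype.card_fin, ← Nat.cast_smul_eq_nsmul ℝ,
      smul_smul, inv_mul_cancel₀ this, one_smul]
  · intro j _
    exact integrable_comp_eval (μ := fun _ : Fin n => μ) hf

variable [CompleteSpace E]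

/-- Bias-variance decomposition: the cross term vanishes because f minus its mean integrates to
zero. It is used with c = 0 for second moments, and with other c because the mean minimizes the
expected squared distance. -/
lemma integral_norm_sq_eq_add {μ : Measure α} [IsProbabilityMeasure μ] {f : α → E}
    (hf : MemLp f 2 μ) (c : E) :
    ∫ x, ‖f x - c‖ ^ 2 ∂μ = ∫ x, ‖f x - ∫ y, f y ∂μ‖ ^ 2 ∂μ + ‖(∫ y, f y ∂μ) - c‖ ^ 2 := by
  set m := ∫ y, f y ∂μ with hm
  have hi := hf.integrable one_le_two
  have h1 : MemLp (fun x => f x - m) 2 μ := hf.sub (memLp_const m)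
  have h2 := h1.integrable_norm_pow two_ne_zero
  have h3 : Integrable (fun x => f x - m) μ := h1.integrable one_le_two
  have e : ∀ x, ‖f x - c‖ ^ 2
      = ‖f x - m‖ ^ 2 + 2 * inner ℝ (m - c) (f x - m) + ‖m - c‖ ^ 2 := by
    intro x
    have : f x - c = (f x - m) + (m - c) := by abel
    rw [this, norm_add_sq_real, real_inner_comm]
  simp_rw [e]
  have h4 : Integrable (fun x => 2 * inner ℝ (m - c) (f x - m)) μ :=
    (h3.const_inner (m - c)).const_mul 2
  have h5 : Integrable (fun x => ‖f x - m‖ ^ 2 + 2 * inner ℝ (m - c) (f x - m)) μ := h2.add h4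
  rw [integral_add h5 (integrable_const _), integral_add h2 h4, integral_const_mul,
    integral_inner h3, integral_sub hi (integrable_const _)]
  simp [← hm]

variable [MeasurableSpace E] [BorelSpace E] [SecondCountableTopology E]

/-- The second moment of the average of independent centred vectors. -/
lemma integral_norm_sq_average_of_centered {μ : Measure α} [IsProbabilityMeasure μ] {f : α → E}
    (hm : Measurable f) (hf : MemLp f 2 μ) (h0 : ∫ a, f a ∂μ = 0) {n : ℕ} (hn : 1 ≤ n) :
    ∫ x : Fin n → α, ‖(n : ℝ)⁻¹ • ∑ j, f (x j)‖ ^ 2 ∂(Measure.pi fun _ => μ)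
      = (∫ a, ‖f a‖ ^ 2 ∂μ) / n := by
  have hn0 : (n : ℝ) ≠ 0 := by positivity
  set π := Measure.pi fun _ : Fin n => μ
  have hj : ∀ j, MemLp (fun x : Fin n → α => f (x j)) 2 π := fun j =>
    hf.comp_measurePreserving (measurePreserving_eval (fun _ : Fin n => μ) j)
  have hind : iIndepFun (fun (j : Fin n) (x : Fin n → α) => f (x j)) π :=
    iIndepFun_pi (X := fun (_ : Fin n) (a : α) => f a) fun _ => hm.aemeasurable
  have hint : ∀ i j, Integrable (fun x => inner ℝ (f (x i)) (f (x j))) π := fun i j =>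
    integrable_inner_of_memLp (hj i) (hj j)
  have key : ∀ i j, ∫ x, inner ℝ (f (x i)) (f (x j)) ∂π
      = if i = j then ∫ a, ‖f a‖ ^ 2 ∂μ else 0 := by
    intro i j
    split_ifs with h
    · subst h
      simp_rw [real_inner_self_eq_norm_sq]
      exact integral_comp_eval (μ := fun _ : Fin n => μ) (f := fun a => ‖f a‖ ^ 2) (i := i)
        (hm.norm.pow_const 2).aestronglyMeasurable
    -- Off the diagonal, independence turns the expected inner product into the inner product of the
    -- means, which are zero.
    · have := (hind.indepFun h).integral_bilin ((hj i).integrable one_le_two)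
        ((hj j).integrable one_le_two) (innerSL ℝ (E := E))
      have hz : ∫ x : Fin n → α, f (x i) ∂π = 0 :=
        (integral_comp_eval (μ := fun _ : Fin n => μ) hm.aestronglyMeasurable).trans h0
      rw [hz, map_zero] at this
      exact this
  have e : ∀ x : Fin n → α, ‖(n : ℝ)⁻¹ • ∑ j, f (x j)‖ ^ 2
      = ((n : ℝ)⁻¹) ^ 2 * ∑ i, ∑ j, inner ℝ (f (x i)) (f (x j)) := by
    intro x
    rw [norm_smul, mul_pow, ← real_inner_self_eq_norm_sq (∑ j, f (x j)), sum_inner]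
    simp_rw [inner_sum]
    simp
  simp_rw [e]
  rw [integral_const_mul, integral_finsetSum _ fun i _ => integrable_finsetSum _ fun j _ => hint i j]
  simp_rw [integral_finsetSum _ fun j _ => hint _ j, key]
  simp
  field_simp

/-- The variance of the average of `n` independent copies of a random vector. -/
lemma integral_norm_sq_average_sub {μ : Measure α} [IsProbabilityMeasure μ] {f : α → E}
    (hm : Measurable f) (hf : MemLp f 2 μ) {n : ℕ} (hn : 1 ≤ n) :
    ∫ x : Fin n → α, ‖(n : ℝ)⁻¹ • ∑ j, f (x j) - ∫ a, f a ∂μ‖ ^ 2 ∂(Measure.pi fun _ => μ)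
      = (∫ a, ‖f a - ∫ a, f a ∂μ‖ ^ 2 ∂μ) / n := by
  have hn0 : (n : ℝ) ≠ 0 := by positivity
  set m := ∫ a, f a ∂μ with hmdef
  rw [← integral_norm_sq_average_of_centered (f := fun a => f a - m) (hm.sub_const m)
    (hf.sub (memLp_const m)) _ hn]
  · congr 1
    ext x
    rw [Finset.sum_sub_distrib, smul_sub, Finset.sum_const, Finset.card_univ, Fintype.card_fin,
      ← Nat.cast_smul_eq_nsmul ℝ, smul_smul, inv_mul_cancel₀ hn0, one_smul]
  · rw [integral_sub (hf.integrable one_le_two) (integrable_const _)]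
    simp [← hmdef]

end Probability

/-! ### Deterministic estimates for the adapted loss of a single task. -/

section Analysis

variable {d : ℕ} {f : Vec d → ℝ} {L ρ α : ℝ}

/-- The gradient of the adapted loss `w ↦ f (w - α ∇f(w))`. -/
def adaptedGrad (f : Vec d → ℝ) (α : ℝ) (w : Vec d) : Vec d :=
  gradient f (w - α • gradient f w) - α • hessian f w (gradient f (w - α • gradient f w))

lemma hasFDerivAt_gradient (hf : ContDiff ℝ 2 f) (w : Vec d) :
    HasFDerivAt (fun u => gradient f u) (hessian f w) w := by
  have h : ContDiff ℝ 1 (fderiv ℝ f) := hf.fderiv_right (by norm_num)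
  have h1 : DifferentiableAt ℝ (fun u => gradient f u) w :=
    (((InnerProductSpace.toDual ℝ (Vec d)).symm.toContinuousLinearEquiv.toContinuousLinearMap
      |>.differentiableAt).comp w ((h.differentiable one_ne_zero) w))
  exact h1.hasFDerivAt

lemma hasGradientAt_of_contDiff (hf : ContDiff ℝ 2 f) (w : Vec d) :
    HasGradientAt f (gradient f w) w :=
  ((hf.differentiable two_ne_zero) w).hasGradientAt

/-- Pairing the derivative of the gradient field with a vector gives the second Fréchet derivative
of f, which is symmetric for a C² function. -/
lemma inner_hessian_symm (hf : ContDiff ℝ 2 f) (w a b : Vec d) :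
    inner ℝ (hessian f w a) b = inner ℝ a (hessian f w b) := by
  have h : ContDiff ℝ 1 (fderiv ℝ f) := hf.fderiv_right (by norm_num)
  have h1 : HasFDerivAt (fderiv ℝ f) (fderiv ℝ (fderiv ℝ f) w) w :=
    (h.differentiable one_ne_zero w).hasFDerivAt
  have h3 : ∀ a b, inner ℝ (hessian f w a) b = fderiv ℝ (fderiv ℝ f) w a b := by
    intro a b
    have h4 : HasFDerivAt (fun u => fderiv ℝ f u b) ((fderiv ℝ (fderiv ℝ f) w).flip b) w := by
      simpa using h1.clm_apply (hasFDerivAt_const b w)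
    have h5 : HasFDerivAt (fun u => inner ℝ b (gradient f u))
        ((innerSL ℝ b).comp (hessian f w)) w :=
      (innerSL ℝ b).hasFDerivAt.comp w (hasFDerivAt_gradient hf w)
    have h6 : (fun u => inner ℝ b (gradient f u)) = fun u => fderiv ℝ f u b := by
      ext u
      rw [real_inner_comm, gradient, InnerProductSpace.toDual_symm_apply]
    rw [h6] at h5
    have := congrArg (fun T => T a) (h5.unique h4)
    simpa [real_inner_comm] using this
  have hs : IsSymmSndFDerivAt ℝ f w := hf.contDiffAt.isSymmSndFDerivAt (by simp)
  rw [h3, hs a b, ← h3, real_inner_comm]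

lemma norm_hessian_le (hf : ContDiff ℝ 2 f) (hL : 0 ≤ L)
    (hg : ∀ w u, ‖gradient f w - gradient f u‖ ≤ L * ‖w - u‖) (w : Vec d) : ‖hessian f w‖ ≤ L :=
  (hasFDerivAt_gradient hf w).le_of_lip' hL (Filter.Eventually.of_forall fun u => hg u w)

lemma norm_hessian_apply_le (hf : ContDiff ℝ 2 f) (hL : 0 ≤ L)
    (hg : ∀ w u, ‖gradient f w - gradient f u‖ ≤ L * ‖w - u‖) (w v : Vec d) :
    ‖hessian f w v‖ ≤ L * ‖v‖ :=
  (hessian f w).le_of_opNorm_le (norm_hessian_le hf hL hg w) v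

/-- The second order upper bound for functions whose gradient is Lipschitz at a point. -/
lemma le_add_inner_add_sq {F : Vec d → ℝ} {G : Vec d → Vec d} {K : ℝ} {w : Vec d}
    (hF : ∀ u, HasGradientAt F (G u) u) (hG : ∀ u, ‖G u - G w‖ ≤ K * ‖u - w‖) (u : Vec d) :
    F u ≤ F w + inner ℝ (G w) (u - w) + K / 2 * ‖u - w‖ ^ 2 := by
  -- Along the segment, F minus its claimed quadratic majorant has nonpositive derivative. Only
  -- increments of G from w enter, so K may depend on w.
  have hd : ∀ t : ℝ, HasDerivAt (fun t : ℝ => F (w + t • (u - w)) - t * inner ℝ (G w) (u - w)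
      - K / 2 * ‖u - w‖ ^ 2 * t ^ 2)
      (inner ℝ (G (w + t • (u - w))) (u - w) - 1 * inner ℝ (G w) (u - w)
        - K / 2 * ‖u - w‖ ^ 2 * (2 * t)) t := by
    intro t
    have h1 : HasDerivAt (fun t : ℝ => w + t • (u - w)) ((1 : ℝ) • (u - w)) t :=
      ((hasDerivAt_id t).smul_const (u - w)).const_add w
    have h2 := (hF (w + t • (u - w))).hasFDerivAt.comp_hasDerivAt t h1
    have h3 : HasDerivAt (fun t : ℝ => F (w + t • (u - w)))
        (inner ℝ (G (w + t • (u - w))) (u - w)) t := by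
      simpa [Function.comp_def] using h2
    refine (h3.sub ((hasDerivAt_id t).mul_const _)).sub ?_
    have := ((hasDerivAt_pow 2 t).const_mul (K / 2 * ‖u - w‖ ^ 2))
    simpa using this
  have hanti : AntitoneOn (fun t : ℝ => F (w + t • (u - w)) - t * inner ℝ (G w) (u - w)
      - K / 2 * ‖u - w‖ ^ 2 * t ^ 2) (Set.Icc 0 1) := by
    refine antitoneOn_of_hasDerivWithinAt_nonpos (convex_Icc 0 1)
      (fun t _ => (hd t).continuousAt.continuousWithinAt)
      (fun t _ => (hd t).hasDerivWithinAt) ?_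
    intro t ht
    rw [interior_Icc] at ht
    have h1 : inner ℝ (G (w + t • (u - w))) (u - w) - inner ℝ (G w) (u - w)
        ≤ K * (t * ‖u - w‖) * ‖u - w‖ := by
      rw [← inner_sub_left]
      refine (real_inner_le_norm _ _).trans ?_
      gcongr
      refine (hG _).trans_eq ?_
      rw [add_sub_cancel_left, norm_smul, Real.norm_of_nonneg ht.1.le]
    nlinarith
  have := hanti (Set.left_mem_Icc.2 zero_le_one) (Set.right_mem_Icc.2 zero_le_one) zero_le_one
  simp at this
  linarith

lemma abs_sub_sub_inner_le (hf : ContDiff ℝ 2 f)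
    (hg : ∀ w u, ‖gradient f w - gradient f u‖ ≤ L * ‖w - u‖) (w u : Vec d) :
    |f u - f w - inner ℝ (gradient f w) (u - w)| ≤ L / 2 * ‖u - w‖ ^ 2 := by
  rw [abs_le]
  constructor
  · have := le_add_inner_add_sq (F := fun x => - f x) (G := fun x => - gradient f x) (w := w) (K := L)
      (fun x => by
        rw [hasGradientAt_iff_hasFDerivAt, map_neg]
        exact (hasGradientAt_of_contDiff hf x).hasFDerivAt.neg)
      (fun x => by rw [neg_sub_neg, norm_sub_rev]; exact hg x w) u
    rw [inner_neg_left] at this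
    linarith
  · have := le_add_inner_add_sq (F := f) (fun x => hasGradientAt_of_contDiff hf x)
      (fun x => hg x w) u
    linarith

/-- The chain rule puts the adjoint of I − αH in front of the gradient at the adapted point;
symmetry of the Hessian H removes the adjoint. -/
lemma hasGradientAt_adapted (hf : ContDiff ℝ 2 f) (w : Vec d) :
    HasGradientAt (fun u => f (u - α • gradient f u)) (adaptedGrad f α w) w := by
  have h1 : HasFDerivAt (fun u => u - α • gradient f u)
      (ContinuousLinearMap.id ℝ (Vec d) - α • hessian f w) w :=
    (hasFDerivAt_id w).sub ((hasFDerivAt_gradient hf w).const_smul α)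
  have h2 := (hasGradientAt_of_contDiff hf (w - α • gradient f w)).hasFDerivAt.comp w h1
  rw [hasGradientAt_iff_hasFDerivAt]
  refine h2.congr_fderiv ?_
  ext v
  simp only [adaptedGrad, ContinuousLinearMap.comp_apply, InnerProductSpace.toDual_apply_apply,
    sub_apply, smul_apply, ContinuousLinearMap.id_apply,
    inner_sub_left, inner_sub_right, inner_smul_left, inner_smul_right, RCLike.conj_to_real]
  rw [inner_hessian_symm hf]

section

variable (hf : ContDiff ℝ 2 f) (hL : 0 < L) (hα : 0 < α) (hαL : α ≤ 1 / (6 * L))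
  (hg : ∀ w u, ‖gradient f w - gradient f u‖ ≤ L * ‖w - u‖)

-- The source of the numerical constants below: one inner step changes a gradient by at most a sixth
-- of the norm of the gradient at the start, and I − αH has norm at most 7/6.
include hL hαL in
lemma mul_le_sixth : α * L ≤ 1 / 6 := by
  rw [le_div_iff₀ (by positivity)] at hαL
  linarith

include hL hα hαL hg

lemma norm_gradient_adapted_sub_le (w : Vec d) :
    ‖gradient f (w - α • gradient f w) - gradient f w‖ ≤ 1 / 6 * ‖gradient f w‖ := by
  have h := mul_le_sixth hL hαL
  refine (hg _ _).trans ?_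
  rw [sub_sub_cancel_left, norm_neg, norm_smul, Real.norm_of_nonneg hα.le]
  nlinarith [norm_nonneg (gradient f w)]

lemma norm_gradient_adapted_le (w : Vec d) :
    ‖gradient f (w - α • gradient f w)‖ ≤ 7 / 6 * ‖gradient f w‖ := by
  have h := norm_gradient_adapted_sub_le hL hα hαL hg w
  have := norm_add_le (gradient f (w - α • gradient f w) - gradient f w) (gradient f w)
  rw [sub_add_cancel] at this
  linarith

include hf

lemma norm_sub_smul_hessian_le (w v : Vec d) : ‖v - α • hessian f w v‖ ≤ 7 / 6 * ‖v‖ := by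
  have h := mul_le_sixth hL hαL
  refine (norm_sub_le _ _).trans ?_
  rw [norm_smul, Real.norm_of_nonneg hα.le]
  nlinarith [norm_hessian_apply_le hf hL.le hg w v, norm_nonneg v]

lemma norm_adaptedGrad_le (w : Vec d) : ‖adaptedGrad f α w‖ ≤ 49 / 36 * ‖gradient f w‖ := by
  have h1 := norm_sub_smul_hessian_le hf hL hα hαL hg w (gradient f (w - α • gradient f w))
  have h2 := norm_gradient_adapted_le hL hα hαL hg w
  unfold adaptedGrad
  linarith

lemma norm_adaptedGrad_sub_gradient_le (w : Vec d) :
    ‖adaptedGrad f α w - gradient f w‖ ≤ 13 / 36 * ‖gradient f w‖ := by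
  have h := mul_le_sixth hL hαL
  have h1 := norm_gradient_adapted_sub_le hL hα hαL hg w
  have h2 := norm_gradient_adapted_le hL hα hαL hg w
  have h3 := norm_hessian_apply_le hf hL.le hg w (gradient f (w - α • gradient f w))
  have h4 : ‖α • hessian f w (gradient f (w - α • gradient f w))‖
      ≤ 1 / 6 * ‖gradient f (w - α • gradient f w)‖ := by
    rw [norm_smul, Real.norm_of_nonneg hα.le]
    nlinarith [norm_nonneg (gradient f (w - α • gradient f w))]
  have e : adaptedGrad f α w - gradient f w = (gradient f (w - α • gradient f w) - gradient f w)
      - α • hessian f w (gradient f (w - α • gradient f w)) := by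
    unfold adaptedGrad; abel
  rw [e]
  refine (norm_sub_le _ _).trans ?_
  linarith

lemma norm_adaptedGrad_sub_le (hH : ∀ w u, ‖hessian f w - hessian f u‖ ≤ ρ * ‖w - u‖)
    (u w : Vec d) :
    ‖adaptedGrad f α u - adaptedGrad f α w‖
      ≤ 7 / 12 * (4 * L + 2 * ρ * α * ‖gradient f w‖) * ‖u - w‖ := by
  have h := mul_le_sixth hL hαL
  set a := gradient f (u - α • gradient f u)
  set b := gradient f (w - α • gradient f w)
  have h1 : ‖a - b‖ ≤ 7 / 6 * L * ‖u - w‖ := by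
    refine (hg _ _).trans ?_
    have e : u - α • gradient f u - (w - α • gradient f w)
        = (u - w) - α • (gradient f u - gradient f w) := by
      rw [smul_sub]; abel
    have h2 : ‖α • (gradient f u - gradient f w)‖ ≤ 1 / 6 * ‖u - w‖ := by
      rw [norm_smul, Real.norm_of_nonneg hα.le]
      nlinarith [hg u w, norm_nonneg (u - w)]
    rw [e]
    have h3 := norm_sub_le (u - w) (α • (gradient f u - gradient f w))
    calc _ ≤ L * (‖u - w‖ + 1 / 6 * ‖u - w‖) := by gcongr; linarith
      _ = _ := by ring
  have h2 := norm_gradient_adapted_le hL hα hαL hg w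
  have h3 := norm_sub_smul_hessian_le hf hL hα hαL hg u (a - b)
  have h4 : ‖α • (hessian f u - hessian f w) b‖ ≤ α * (ρ * ‖u - w‖ * (7 / 6 * ‖gradient f w‖)) := by
    rw [norm_smul, Real.norm_of_nonneg hα.le]
    refine mul_le_mul_of_nonneg_left ?_ hα.le
    refine ((hessian f u - hessian f w).le_opNorm b).trans ?_
    exact mul_le_mul (hH u w) h2 (norm_nonneg _) ((norm_nonneg _).trans (hH u w))
  -- The Hessian increment is paired with b, the gradient at the adapted point of w and not of u;
  -- this is why the constant involves only ‖∇f(w)‖. The other part costs (7/6)² L, which is below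
  -- 7/12 · 4L.
  have e : adaptedGrad f α u - adaptedGrad f α w
      = ((a - b) - α • hessian f u (a - b)) - α • (hessian f u - hessian f w) b := by
    simp only [adaptedGrad, map_sub, sub_apply, smul_sub]
    abel
  rw [e]
  refine (norm_sub_le _ _).trans ?_
  nlinarith [mul_nonneg hL.le (norm_nonneg (u - w))]

end

end Analysis

lemma measurable_clm_apply {d : ℕ} {γ : Type*} [MeasurableSpace γ] {T : γ → (Vec d →L[ℝ] Vec d)}
    {v : γ → Vec d} (hT : Measurable T) (hv : Measurable v) : Measurable fun x => T x (v x) :=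
  (isBoundedBilinearMap_apply (𝕜 := ℝ) (E := Vec d) (F := Vec d)).continuous.measurable.comp
    (hT.prodMk hv)

/-! ### Regularity of the MAML objective and comparison of its gradient with the task gradients. -/

namespace Problem

variable {d : ℕ} {ι Θ : Type*} [MeasurableSpace ι] [MeasurableSpace Θ] {P : Problem d ι Θ}
  {L ρ α σ σt σH : ℝ}

/-- The gradient of the MAML objective, written as an expectation over the tasks. -/
def metaGrad (P : Problem d ι Θ) (α : ℝ) (w : Vec d) : Vec d :=
  ∫ i, adaptedGrad (P.f i) α w ∂P.p

/-- The smoothness parameter `4 L + 2 ρ α E‖∇f_i(w)‖` of the MAML objective at `w`. -/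
def smoothness (P : Problem d ι Θ) (L ρ α : ℝ) (w : Vec d) : ℝ :=
  4 * L + 2 * ρ * α * ∫ i, ‖gradient (P.f i) w‖ ∂P.p

lemma le_smoothness (hα : 0 ≤ α) (hρ : 0 ≤ ρ) (w : Vec d) : 4 * L ≤ P.smoothness L ρ α w := by
  have : 0 ≤ ∫ i, ‖gradient (P.f i) w‖ ∂P.p := integral_nonneg fun i => norm_nonneg _
  have : 0 ≤ 2 * ρ * α * ∫ i, ‖gradient (P.f i) w‖ ∂P.p := by positivity
  unfold smoothness
  linarith

namespace Assumptions

variable (hA : P.Assumptions L ρ α σ σt σH)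
include hA

/-- Unbiasedness writes the gradient as a kernel integral of the jointly measurable stochastic
gradient, so joint measurability in task and point is inherited. -/
lemma measurable_gradient {γ : Type*} [MeasurableSpace γ] {i : γ → ι} {w : γ → Vec d}
    (hi : Measurable i) (hw : Measurable w) :
    Measurable fun x => gradient (P.f (i x)) (w x) := by
  simp_rw [← hA.sgrad_unbiased]
  have h : StronglyMeasurable (Function.uncurry fun (x : γ) θ => P.sgrad (i x) (w x) θ) :=
    (hA.measurable_sgrad.comp
      ((hi.comp measurable_fst).prodMk ((hw.comp measurable_fst).prodMk measurable_snd)))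
      |>.stronglyMeasurable
  exact (h.integral_kernel_prod_right (κ := P.data.comap i hi)).measurable

lemma measurable_hessian {γ : Type*} [MeasurableSpace γ] {i : γ → ι} {w : γ → Vec d}
    (hi : Measurable i) (hw : Measurable w) :
    Measurable fun x => hessian (P.f (i x)) (w x) := by
  simp_rw [← hA.shess_unbiased]
  have h : StronglyMeasurable (Function.uncurry fun (x : γ) θ => P.shess (i x) (w x) θ) :=
    (hA.measurable_shess.comp
      ((hi.comp measurable_fst).prodMk ((hw.comp measurable_fst).prodMk measurable_snd)))
      |>.stronglyMeasurable
  exact (h.integral_kernel_prod_right (κ := P.data.comap i hi)).measurable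

lemma measurable_loss {γ : Type*} [MeasurableSpace γ] {i : γ → ι} {w : γ → Vec d}
    (hi : Measurable i) (hw : Measurable w) :
    Measurable fun x => P.f (i x) (w x) := by
  have h := measurable_uncurry_of_continuous_of_measurable (u := fun w i => P.f i w)
    (fun i => (hA.contDiff i).continuous) hA.measurable_f
  exact h.comp (hw.prodMk hi)

lemma measurable_adaptedGrad {γ : Type*} [MeasurableSpace γ] {i : γ → ι} {w : γ → Vec d}
    (hi : Measurable i) (hw : Measurable w) :
    Measurable fun x => adaptedGrad (P.f (i x)) α (w x) := by
  have h := hA.measurable_gradient hi (hw.sub ((hA.measurable_gradient hi hw).const_smul α))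
  exact h.sub ((measurable_clm_apply (hA.measurable_hessian hi hw) h).const_smul α)

lemma memLp_gradient_sub (w : Vec d) :
    MemLp (fun i => gradient (P.f i) w - P.meanGrad w) 2 P.p ∧
      ∫ i, ‖gradient (P.f i) w - P.meanGrad w‖ ^ 2 ∂P.p ≤ σ ^ 2 := by
  refine memLp_two_of_lintegral_le
    ((hA.measurable_gradient measurable_id measurable_const).sub_const _).aestronglyMeasurable
    (sq_nonneg σ) ?_
  simp_rw [← enorm_neg (gradient _ w - _), neg_sub]
  exact hA.task_variance w

lemma memLp_gradient (w : Vec d) : MemLp (fun i => gradient (P.f i) w) 2 P.p := by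
  refine ((hA.memLp_gradient_sub w).1.add (memLp_const (P.meanGrad w))).congr_norm
    (hA.measurable_gradient measurable_id measurable_const).aestronglyMeasurable
    (Filter.Eventually.of_forall fun i => ?_)
  simp

lemma integrable_gradient (w : Vec d) : Integrable (fun i => gradient (P.f i) w) P.p :=
  (hA.memLp_gradient w).integrable one_le_two

lemma integral_norm_gradient_le (hσ : 0 ≤ σ) (w : Vec d) :
    ∫ i, ‖gradient (P.f i) w‖ ∂P.p ≤ ‖P.meanGrad w‖ + σ := by
  have h := hA.memLp_gradient_sub w
  have h1 := integral_norm_le_of_sq_le h.1 hσ h.2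
  have h2 : ∫ i, ‖gradient (P.f i) w‖ ∂P.p
      ≤ ∫ i, (‖P.meanGrad w‖ + ‖gradient (P.f i) w - P.meanGrad w‖) ∂P.p := by
    refine integral_mono (hA.integrable_gradient w).norm
      ((integrable_const _).add (h.1.integrable one_le_two).norm) fun i => ?_
    exact norm_le_norm_add_norm_sub' _ _
  rw [integral_add (integrable_const _) (h.1.integrable one_le_two).norm] at h2
  simp at h2
  linarith

lemma integral_norm_sq_gradient_le (w : Vec d) :
    ∫ i, ‖gradient (P.f i) w‖ ^ 2 ∂P.p ≤ ‖P.meanGrad w‖ ^ 2 + σ ^ 2 := by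
  have h := integral_norm_sq_eq_add (hA.memLp_gradient w) 0
  have h2 := (hA.memLp_gradient_sub w).2
  simp only [sub_zero] at h
  rw [h]
  change ∫ i, ‖gradient (P.f i) w - P.meanGrad w‖ ^ 2 ∂P.p + ‖P.meanGrad w‖ ^ 2 ≤ _
  linarith

/-- The second-order expansion at w bounds the adapted loss by |f_i(w)| plus a multiple of
‖∇f_i(w)‖², and the latter is integrable because the task variance is finite. -/
lemma integrable_adaptedLoss (hα : 0 < α) (w : Vec d) :
    Integrable (fun i => P.f i (w - α • gradient (P.f i) w)) P.p := by
  have h2 := (hA.memLp_gradient w).integrable_norm_pow two_ne_zero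
  refine ((hA.integrable_f w).norm.add (h2.const_mul (α + L / 2 * α ^ 2))).mono'
    (hA.measurable_loss measurable_id (measurable_const.sub ((hA.measurable_gradient
      measurable_id measurable_const).const_smul α))).aestronglyMeasurable
    (Filter.Eventually.of_forall fun i => ?_)
  have h := abs_sub_sub_inner_le (hA.contDiff i) (hA.grad_lipschitz i) w
    (w - α • gradient (P.f i) w)
  rw [sub_sub_cancel_left, inner_neg_right, inner_smul_right, real_inner_self_eq_norm_sq, norm_neg,
    norm_smul, Real.norm_of_nonneg hα.le] at h
  simp only [Pi.add_apply, Real.norm_eq_abs]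
  have hs : 0 ≤ α * ‖gradient (P.f i) w‖ ^ 2 := by positivity
  rw [abs_le] at h ⊢
  have h3 := neg_abs_le (P.f i w)
  have h4 := le_abs_self (P.f i w)
  constructor <;> nlinarith

variable (hL : 0 < L) (hα : 0 < α) (hαL : α ≤ 1 / (6 * L))
include hL hα hαL

lemma integrable_adaptedGrad (w : Vec d) :
    Integrable (fun i => adaptedGrad (P.f i) α w) P.p := by
  refine ((hA.integrable_gradient w).norm.const_mul (49 / 36)).mono'
    (hA.measurable_adaptedGrad measurable_id measurable_const).aestronglyMeasurable
    (Filter.Eventually.of_forall fun i => ?_)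
  exact norm_adaptedGrad_le (hA.contDiff i) hL hα hαL (hA.grad_lipschitz i) w

lemma norm_metaGrad_sub_meanGrad_le (w : Vec d) :
    ‖P.metaGrad α w - P.meanGrad w‖ ≤ 13 / 36 * ∫ i, ‖gradient (P.f i) w‖ ∂P.p := by
  rw [metaGrad, meanGrad, ← integral_sub (hA.integrable_adaptedGrad hL hα hαL w)
    (hA.integrable_gradient w), ← integral_const_mul]
  refine norm_integral_le_of_norm_le ((hA.integrable_gradient w).norm.const_mul _)
    (Filter.Eventually.of_forall fun i => ?_)
  exact norm_adaptedGrad_sub_gradient_le (hA.contDiff i) hL hα hαL (hA.grad_lipschitz i) w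

/-- Adaptation moves the mean gradient by at most 13/36 (‖mean gradient‖ + σ); as 13/36 < 1, this
can be absorbed on the left, leaving the factor 23/36. -/
lemma norm_meanGrad_le (hσ : 0 ≤ σ) (w : Vec d) :
    ‖P.meanGrad w‖ ≤ 36 / 23 * ‖P.metaGrad α w‖ + 13 / 23 * σ := by
  have h1 := hA.norm_metaGrad_sub_meanGrad_le hL hα hαL w
  have h2 := hA.integral_norm_gradient_le hσ w
  have h3 := norm_sub_norm_le (P.meanGrad w) (P.metaGrad α w)
  rw [norm_sub_rev] at h3
  linarith

lemma integral_norm_gradient_le_metaGrad (hσ : 0 ≤ σ) (w : Vec d) :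
    ∫ i, ‖gradient (P.f i) w‖ ∂P.p ≤ 2 * (‖P.metaGrad α w‖ + σ) := by
  have h1 := hA.norm_meanGrad_le hL hα hαL hσ w
  have h2 := hA.integral_norm_gradient_le hσ w
  linarith [norm_nonneg (P.metaGrad α w)]

lemma integral_norm_sq_gradient_le_metaGrad (hσ : 0 ≤ σ) (w : Vec d) :
    ∫ i, ‖gradient (P.f i) w‖ ^ 2 ∂P.p ≤ 5 * ‖P.metaGrad α w‖ ^ 2 + 2 * σ ^ 2 := by
  have h1 := hA.norm_meanGrad_le hL hα hαL hσ w
  have h2 := hA.integral_norm_sq_gradient_le w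
  have h3 := pow_le_pow_left₀ (norm_nonneg _) h1 2
  nlinarith [sq_nonneg (36 / 23 * ‖P.metaGrad α w‖ - 13 / 23 * σ), sq_nonneg σ,
    sq_nonneg ‖P.metaGrad α w‖]

/-- Differentiation under the integral sign. On the unit ball around w, the Lipschitz bound
dominates the gradients of the adapted losses by an integrable function of the task. -/
lemma hasGradientAt_metaLoss (w : Vec d) :
    HasGradientAt (P.metaLoss α) (P.metaGrad α w) w := by
  rw [hasGradientAt_iff_hasFDerivAt]
  have hmeas : Measurable fun i => InnerProductSpace.toDual ℝ (Vec d) (adaptedGrad (P.f i) α w) :=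
    (InnerProductSpace.toDual ℝ (Vec d)).continuous.measurable.comp
      (hA.measurable_adaptedGrad measurable_id measurable_const)
  have hint : Integrable (fun i => InnerProductSpace.toDual ℝ (Vec d) (adaptedGrad (P.f i) α w))
      P.p := by
    refine (hA.integrable_adaptedGrad hL hα hαL w).norm.mono' hmeas.aestronglyMeasurable
      (Filter.Eventually.of_forall fun i => ?_)
    exact (LinearIsometryEquiv.norm_map _ _).le
  have h := hasFDerivAt_integral_of_dominated_of_fderiv_le (𝕜 := ℝ) (μ := P.p)
    (F := fun u i => P.f i (u - α • gradient (P.f i) u)) (x₀ := w)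
    (F' := fun u i => InnerProductSpace.toDual ℝ (Vec d) (adaptedGrad (P.f i) α u))
    (bound := fun i => 49 / 36 * (‖gradient (P.f i) w‖ + L)) (s := Metric.ball w 1)
    (Metric.ball_mem_nhds w one_pos)
    (Filter.Eventually.of_forall fun u =>
      (hA.integrable_adaptedLoss hα u).aestronglyMeasurable)
    (hA.integrable_adaptedLoss hα w) hmeas.aestronglyMeasurable
    (Filter.Eventually.of_forall fun i u hu => ?_)
    (((hA.integrable_gradient w).norm.add (integrable_const L)).const_mul _)
    (Filter.Eventually.of_forall fun i u _ =>
      (hasGradientAt_adapted (hA.contDiff i) u).hasFDerivAt)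
  · refine h.congr_fderiv ?_
    ext v
    rw [ContinuousLinearMap.integral_apply hint]
    simp only [InnerProductSpace.toDual_apply_apply]
    rw [metaGrad, real_inner_comm, ← integral_inner (hA.integrable_adaptedGrad hL hα hαL w)]
    simp_rw [real_inner_comm]
  · rw [LinearIsometryEquiv.norm_map]
    refine (norm_adaptedGrad_le (hA.contDiff i) hL hα hαL (hA.grad_lipschitz i) u).trans ?_
    have h1 := hA.grad_lipschitz i u w
    have h2 := norm_sub_norm_le (gradient (P.f i) u) (gradient (P.f i) w)
    rw [mem_ball_iff_norm] at hu
    nlinarith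

lemma gradient_metaLoss (w : Vec d) : gradient (P.metaLoss α) w = P.metaGrad α w :=
  (hA.hasGradientAt_metaLoss hL hα hαL w).gradient

/-- The bound for a single task, averaged over the tasks. The constant depends on the base point w
only, which also yields continuity of the meta gradient. -/
lemma norm_metaGrad_sub_le (u w : Vec d) :
    ‖P.metaGrad α u - P.metaGrad α w‖ ≤ 7 / 12 * P.smoothness L ρ α w * ‖u - w‖ := by
  rw [metaGrad, metaGrad, ← integral_sub (hA.integrable_adaptedGrad hL hα hαL u)
    (hA.integrable_adaptedGrad hL hα hαL w)]
  have hi := (hA.integrable_gradient w).norm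
  have e : 7 / 12 * P.smoothness L ρ α w * ‖u - w‖
      = ∫ i, 7 / 12 * (4 * L + 2 * ρ * α * ‖gradient (P.f i) w‖) * ‖u - w‖ ∂P.p := by
    rw [integral_mul_const, integral_const_mul,
      integral_add (integrable_const _) (hi.const_mul _), integral_const_mul]
    simp [smoothness, integral_const_mul]
  rw [e]
  refine norm_integral_le_of_norm_le
    ((((integrable_const _).add (hi.const_mul _)).const_mul _).mul_const _)
    (Filter.Eventually.of_forall fun i => ?_)
  exact norm_adaptedGrad_sub_le (hA.contDiff i) hL hα hαL (hA.grad_lipschitz i)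
    (hA.hess_lipschitz i) u w

lemma continuous_metaGrad : Continuous (P.metaGrad α) := by
  refine continuous_iff_continuousAt.2 fun w => ?_
  rw [ContinuousAt, tendsto_iff_norm_sub_tendsto_zero]
  refine squeeze_zero (fun _ => norm_nonneg _)
    (fun u => hA.norm_metaGrad_sub_le hL hα hαL u w) ?_
  have : Continuous fun u => 7 / 12 * P.smoothness L ρ α w * ‖u - w‖ := by fun_prop
  simpa using this.tendsto w

lemma continuous_metaLoss : Continuous (P.metaLoss α) :=
  continuous_iff_continuousAt.2 fun w =>
    (hA.hasGradientAt_metaLoss hL hα hαL w).hasFDerivAt.continuousAt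

lemma metaLoss_le (w u : Vec d) :
    P.metaLoss α u ≤ P.metaLoss α w + inner ℝ (P.metaGrad α w) (u - w)
      + 7 / 24 * P.smoothness L ρ α w * ‖u - w‖ ^ 2 := by
  have := le_add_inner_add_sq (w := w) (hA.hasGradientAt_metaLoss hL hα hαL)
    (fun u => hA.norm_metaGrad_sub_le hL hα hαL u w) u
  linarith

end Assumptions

end Problem

/-! ### The stochastic update direction: its bias and its second moment. -/

instance isMarkovKernel_datasetKernel {ι Θ : Type*} [MeasurableSpace ι] [MeasurableSpace Θ]
    (κ : Kernel ι Θ) [IsMarkovKernel κ] (n : ℕ) : IsMarkovKernel (datasetKernel κ n) :=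
  ⟨fun i => inferInstanceAs (IsProbabilityMeasure (Measure.pi fun _ : Fin n => κ i))⟩

namespace Problem

variable {d : ℕ} {ι Θ : Type*} [MeasurableSpace ι] [MeasurableSpace Θ] {P : Problem d ι Θ}
  {L ρ α σ σt σH : ℝ}

instance (s : BatchSizes) : IsProbabilityMeasure (P.outerLaw s) := by
  unfold outerLaw; infer_instance

instance (s : BatchSizes) : IsProbabilityMeasure (P.stepsizeLaw s) := by
  unfold stepsizeLaw; infer_instance

instance (s : BatchSizes) : IsProbabilityMeasure (P.iterLaw s) := by
  unfold iterLaw; infer_instance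

namespace Assumptions

variable (hA : P.Assumptions L ρ α σ σt σH)
include hA

lemma measurable_batchGrad {γ : Type*} [MeasurableSpace γ] {n : ℕ} {i : γ → ι} {w : γ → Vec d}
    {D : γ → Fin n → Θ} (hi : Measurable i) (hw : Measurable w) (hD : Measurable D) :
    Measurable fun x => P.batchGrad (i x) (w x) (D x) := by
  have h : Measurable fun x => ∑ j, P.sgrad (i x) (w x) (D x j) :=
    Finset.measurable_fun_sum _ fun j _ =>
      hA.measurable_sgrad.comp (hi.prodMk (hw.prodMk ((measurable_pi_apply j).comp hD)))
  exact h.const_smul (n : ℝ)⁻¹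

lemma measurable_batchHess_apply {γ : Type*} [MeasurableSpace γ] {n : ℕ} {i : γ → ι}
    {w v : γ → Vec d} {D : γ → Fin n → Θ} (hi : Measurable i) (hw : Measurable w)
    (hv : Measurable v) (hD : Measurable D) :
    Measurable fun x => P.batchHess (i x) (w x) (D x) (v x) := by
  refine measurable_clm_apply ?_ hv
  have h : Measurable fun x => ∑ j, P.shess (i x) (w x) (D x j) :=
    Finset.measurable_fun_sum _ fun j _ =>
      hA.measurable_shess.comp (hi.prodMk (hw.prodMk ((measurable_pi_apply j).comp hD)))
  exact h.const_smul (n : ℝ)⁻¹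

lemma measurable_taskDirection {γ : Type*} [MeasurableSpace γ] {s : BatchSizes} {w : γ → Vec d}
    {x : γ → OuterDraw ι Θ s} (hw : Measurable w) (hx : Measurable x) :
    Measurable fun y => P.taskDirection α (w y) (x y) := by
  have hi : Measurable fun y => (x y).1 := hx.fst
  have h1 := hA.measurable_batchGrad hi hw hx.snd.fst
  have h2 := hA.measurable_batchGrad hi (hw.sub (h1.const_smul α)) hx.snd.snd.fst
  exact h2.sub ((hA.measurable_batchHess_apply hi hw h2 hx.snd.snd.snd).const_smul α)

lemma memLp_sgrad (i : ι) (w : Vec d) :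
    MemLp (P.sgrad i w) 2 (P.data i) ∧
      ∫ θ, ‖P.sgrad i w θ - gradient (P.f i) w‖ ^ 2 ∂P.data i ≤ σt ^ 2 := by
  have hm : Measurable (P.sgrad i w) :=
    hA.measurable_sgrad.comp (measurable_const.prodMk (measurable_const.prodMk measurable_id))
  have h := memLp_two_of_lintegral_le (hm.sub_const (gradient (P.f i) w)).aestronglyMeasurable
    (sq_nonneg σt) (hA.sgrad_variance i w)
  refine ⟨?_, h.2⟩
  refine (h.1.add (memLp_const (gradient (P.f i) w))).congr_norm hm.aestronglyMeasurable
    (Filter.Eventually.of_forall fun θ => ?_)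
  simp

lemma memLp_batchGrad (i : ι) (w : Vec d) (n : ℕ) :
    MemLp (fun D => P.batchGrad i w D) 2 (datasetKernel P.data n i) :=
  memLp_average (hA.memLp_sgrad i w).1 n

lemma integral_batchGrad (i : ι) (w : Vec d) {n : ℕ} (hn : 1 ≤ n) :
    ∫ D, P.batchGrad i w D ∂(datasetKernel P.data n i) = gradient (P.f i) w :=
  (integral_average ((hA.memLp_sgrad i w).1.integrable one_le_two) hn).trans
    (hA.sgrad_unbiased i w)

lemma integral_norm_sq_batchGrad_sub_le (i : ι) (w : Vec d) {n : ℕ} (hn : 1 ≤ n) :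
    ∫ D, ‖P.batchGrad i w D - gradient (P.f i) w‖ ^ 2 ∂(datasetKernel P.data n i)
      ≤ σt ^ 2 / n := by
  have hm : Measurable (P.sgrad i w) :=
    hA.measurable_sgrad.comp (measurable_const.prodMk (measurable_const.prodMk measurable_id))
  have h := integral_norm_sq_average_sub hm (hA.memLp_sgrad i w).1 hn
  rw [hA.sgrad_unbiased] at h
  refine h.trans_le ?_
  gcongr
  exact (hA.memLp_sgrad i w).2

lemma integral_norm_batchGrad_sub_le (hσt : 0 ≤ σt) (i : ι) (w : Vec d) {n : ℕ} (hn : 1 ≤ n) :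
    ∫ D, ‖P.batchGrad i w D - gradient (P.f i) w‖ ∂(datasetKernel P.data n i)
      ≤ σt / √n := by
  refine integral_norm_le_of_sq_le ((hA.memLp_batchGrad i w n).sub (memLp_const _))
    (by positivity) ?_
  rw [div_pow, Real.sq_sqrt (by positivity)]
  exact hA.integral_norm_sq_batchGrad_sub_le i w hn

lemma integral_norm_sq_batchGrad_le (i : ι) (w : Vec d) {n : ℕ} (hn : 1 ≤ n) :
    ∫ D, ‖P.batchGrad i w D‖ ^ 2 ∂(datasetKernel P.data n i)
      ≤ ‖gradient (P.f i) w‖ ^ 2 + σt ^ 2 / n := by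
  have h := integral_norm_sq_eq_add (hA.memLp_batchGrad i w n) 0
  simp only [sub_zero, hA.integral_batchGrad i w hn] at h
  rw [h]
  linarith [hA.integral_norm_sq_batchGrad_sub_le i w hn]

/-- Variance reduction by averaging is available in inner product spaces, and the operator norm does
not come from an inner product in general. The Hessian noise is therefore evaluated at a vector
before averaging. -/
lemma memLp_shess_apply (i : ι) (w v : Vec d) :
    MemLp (fun θ => P.shess i w θ v) 2 (P.data i) ∧
      ∫ θ, P.shess i w θ v ∂P.data i = hessian (P.f i) w v ∧
      ∫ θ, ‖P.shess i w θ v - hessian (P.f i) w v‖ ^ 2 ∂P.data i ≤ σH ^ 2 * ‖v‖ ^ 2 := by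
  have hm : Measurable (P.shess i w) :=
    hA.measurable_shess.comp (measurable_const.prodMk (measurable_const.prodMk measurable_id))
  have h := memLp_two_of_lintegral_le (hm.sub_const (hessian (P.f i) w)).aestronglyMeasurable
    (sq_nonneg σH) (hA.shess_variance i w)
  have h1 : MemLp (P.shess i w) 2 (P.data i) := by
    refine (h.1.add (memLp_const (hessian (P.f i) w))).congr_norm hm.aestronglyMeasurable
      (Filter.Eventually.of_forall fun θ => ?_)
    simp
  have hmv : Measurable fun θ => P.shess i w θ v := measurable_clm_apply hm measurable_const
  have h2 : MemLp (fun θ => P.shess i w θ v) 2 (P.data i) := by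
    refine MemLp.of_le_mul (c := ‖v‖) h1 hmv.aestronglyMeasurable
      (Filter.Eventually.of_forall fun θ => ?_)
    rw [mul_comm]
    exact (P.shess i w θ).le_opNorm v
  refine ⟨h2, ?_, ?_⟩
  · rw [← hA.shess_unbiased, ContinuousLinearMap.integral_apply (h1.integrable one_le_two)]
  · have h3 := h.1.integrable_norm_pow two_ne_zero
    calc _ ≤ ∫ θ, ‖P.shess i w θ - hessian (P.f i) w‖ ^ 2 * ‖v‖ ^ 2 ∂P.data i := by
          refine integral_mono_of_nonneg (Filter.Eventually.of_forall fun θ => by positivity)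
            (h3.mul_const _) (Filter.Eventually.of_forall fun θ => ?_)
          change ‖P.shess i w θ v - hessian (P.f i) w v‖ ^ 2
            ≤ ‖P.shess i w θ - hessian (P.f i) w‖ ^ 2 * ‖v‖ ^ 2
          rw [← mul_pow]
          gcongr
          exact (P.shess i w θ - hessian (P.f i) w).le_opNorm v
      _ ≤ _ := by
          rw [integral_mul_const]
          gcongr
          exact h.2

variable (hL : 0 < L) (hα : 0 < α) (hαL : α ≤ 1 / (6 * L))
include hL hα hαL

/-- Moments of the product of the stochastic adaptation matrix with a fixed vector. -/
lemma memLp_sub_batchHess (i : ι) (w v : Vec d) {n : ℕ} (hn : 1 ≤ n)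
    (hH : 2 * α ^ 2 * σH ^ 2 ≤ n) :
    MemLp (fun D => v - α • P.batchHess i w D v) 2 (datasetKernel P.data n i) ∧
      ∫ D, (v - α • P.batchHess i w D v) ∂(datasetKernel P.data n i)
        = v - α • hessian (P.f i) w v ∧
      ∫ D, ‖v - α • P.batchHess i w D v‖ ^ 2 ∂(datasetKernel P.data n i)
        ≤ 67 / 36 * ‖v‖ ^ 2 := by
  obtain ⟨h1, h2, h3⟩ := hA.memLp_shess_apply i w v
  have hm : Measurable fun θ => P.shess i w θ v :=
    measurable_clm_apply (hA.measurable_shess.comp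
      (measurable_const.prodMk (measurable_const.prodMk measurable_id))) measurable_const
  have e : (fun D : Fin n → Θ => P.batchHess i w D v)
      = fun D => (n : ℝ)⁻¹ • ∑ j, P.shess i w (D j) v := by
    ext1 D
    simp [batchHess]
  have a1 : MemLp (fun D => P.batchHess i w D v) 2 (datasetKernel P.data n i) := by
    rw [e]; exact memLp_average h1 n
  have a2 : ∫ D, P.batchHess i w D v ∂(datasetKernel P.data n i) = hessian (P.f i) w v := by
    rw [e, ← h2]; exact integral_average (h1.integrable one_le_two) hn
  have a3 : ∫ D, ‖P.batchHess i w D v - hessian (P.f i) w v‖ ^ 2 ∂(datasetKernel P.data n i)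
      ≤ σH ^ 2 * ‖v‖ ^ 2 / n := by
    have := integral_norm_sq_average_sub hm h1 hn
    rw [h2] at this
    simp_rw [congrFun e]
    refine this.trans_le ?_
    gcongr
  have b1 : MemLp (fun D => v - α • P.batchHess i w D v) 2 (datasetKernel P.data n i) :=
    (memLp_const v).sub (a1.const_smul α)
  have b2 : ∫ D, (v - α • P.batchHess i w D v) ∂(datasetKernel P.data n i)
      = v - α • hessian (P.f i) w v := by
    have hi : Integrable (fun D => α • P.batchHess i w D v) (datasetKernel P.data n i) :=
      (a1.integrable one_le_two).smul α
    rw [integral_sub (integrable_const _) hi, integral_smul, a2]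
    simp
  refine ⟨b1, b2, ?_⟩
  -- The constant is 67/36 = (7/6)² + 1/2: the squared norm of the mean, and a variance that the
  -- lower bound on n pushes below ‖v‖²/2.
  have h := integral_norm_sq_eq_add b1 0
  simp only [sub_zero, b2] at h
  rw [h]
  have c1 : ∀ D : Fin n → Θ, ‖v - α • P.batchHess i w D v - (v - α • hessian (P.f i) w v)‖ ^ 2
      = α ^ 2 * ‖P.batchHess i w D v - hessian (P.f i) w v‖ ^ 2 := by
    intro D
    rw [sub_sub_sub_cancel_left, ← smul_sub, norm_smul, mul_pow, norm_sub_rev, Real.norm_eq_abs,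
      sq_abs]
  simp_rw [c1]
  rw [integral_const_mul]
  have c2 := norm_sub_smul_hessian_le (hA.contDiff i) hL hα hαL (hA.grad_lipschitz i) w v
  have c3 := pow_le_pow_left₀ (norm_nonneg _) c2 2
  have hn0 : (0 : ℝ) < n := by positivity
  have c4 : α ^ 2 * (σH ^ 2 * ‖v‖ ^ 2 / n) ≤ 1 / 2 * ‖v‖ ^ 2 := by
    rw [← mul_div_assoc, div_le_iff₀ hn0]
    nlinarith [sq_nonneg ‖v‖]
  have c5 := mul_le_mul_of_nonneg_left a3 (sq_nonneg α)
  nlinarith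

/-- Moments of the stochastic direction of a task for a fixed adapted point `u`. -/
lemma memLp_outer_direction (i : ι) (w u : Vec d) {n m : ℕ} (hn : 1 ≤ n) (hm : 1 ≤ m)
    (hH : 2 * α ^ 2 * σH ^ 2 ≤ m) :
    MemLp (fun D : (Fin n → Θ) × (Fin m → Θ) =>
        P.batchGrad i u D.1 - α • P.batchHess i w D.2 (P.batchGrad i u D.1)) 2
        ((datasetKernel P.data n i).prod (datasetKernel P.data m i)) ∧
      ∫ D : (Fin n → Θ) × (Fin m → Θ),
        (P.batchGrad i u D.1 - α • P.batchHess i w D.2 (P.batchGrad i u D.1))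
        ∂((datasetKernel P.data n i).prod (datasetKernel P.data m i))
        = gradient (P.f i) u - α • hessian (P.f i) w (gradient (P.f i) u) ∧
      ∫ D : (Fin n → Θ) × (Fin m → Θ),
        ‖P.batchGrad i u D.1 - α • P.batchHess i w D.2 (P.batchGrad i u D.1)‖ ^ 2
        ∂((datasetKernel P.data n i).prod (datasetKernel P.data m i))
        ≤ 67 / 36 * (‖gradient (P.f i) u‖ ^ 2 + σt ^ 2 / n) := by
  have hg := hA.memLp_batchGrad i u n
  have hgm : Measurable fun D : (Fin n → Θ) × (Fin m → Θ) => P.batchGrad i u D.1 :=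
    hA.measurable_batchGrad measurable_const measurable_const measurable_fst
  have hmeas : Measurable (fun D : (Fin n → Θ) × (Fin m → Θ) =>
        P.batchGrad i u D.1 - α • P.batchHess i w D.2 (P.batchGrad i u D.1)) :=
    hgm.sub ((hA.measurable_batchHess_apply measurable_const measurable_const hgm
      measurable_snd).const_smul α)
  -- With the gradient dataset frozen, its stochastic gradient is a fixed vector, and the
  -- independent Hessian dataset is integrated out first.
  have h := memLp_prod hmeas
    (fun D => (hA.memLp_sub_batchHess hL hα hαL i w (P.batchGrad i u D) hm hH).1)
    (fun D => (hA.memLp_sub_batchHess hL hα hαL i w (P.batchGrad i u D) hm hH).2.2)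
    ((hg.integrable_norm_pow two_ne_zero).const_mul _)
  refine ⟨h.1, ?_, ?_⟩
  · rw [integral_prod _ (h.1.integrable one_le_two)]
    simp only [fun D => (hA.memLp_sub_batchHess hL hα hαL i w (P.batchGrad i u D) hm hH).2.1]
    have hi := hg.integrable one_le_two
    have hi' : Integrable (fun D => α • hessian (P.f i) w (P.batchGrad i u D))
        (datasetKernel P.data n i) := ((hessian (P.f i) w).integrable_comp hi).smul α
    rw [integral_sub hi hi', integral_smul,
      ContinuousLinearMap.integral_comp_comm _ hi, hA.integral_batchGrad i u hn]
  · refine h.2.trans ?_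
    rw [integral_const_mul]
    gcongr
    exact hA.integral_norm_sq_batchGrad_le i u hn

/-- Moments of the stochastic direction of a task. -/
lemma memLp_task_direction (hσt : 0 ≤ σt) (i : ι) (w : Vec d) {s : BatchSizes} (h1 : 1 ≤ s.Din)
    (h2 : 1 ≤ s.Do) (h3 : 1 ≤ s.Dh) (hH : 2 * α ^ 2 * σH ^ 2 ≤ s.Dh) :
    MemLp (fun D => P.taskDirection (s := s) α w (i, D)) 2
        ((datasetKernel P.data s.Din ×ₖ (datasetKernel P.data s.Do ×ₖ datasetKernel P.data s.Dh))
          i) ∧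
      ‖∫ D, P.taskDirection (s := s) α w (i, D)
        ∂((datasetKernel P.data s.Din ×ₖ (datasetKernel P.data s.Do ×ₖ datasetKernel P.data s.Dh))
          i) - adaptedGrad (P.f i) α w‖ ≤ 7 / 36 * (σt / √s.Din) ∧
      ∫ D, ‖P.taskDirection (s := s) α w (i, D)‖ ^ 2
        ∂((datasetKernel P.data s.Din ×ₖ (datasetKernel P.data s.Do ×ₖ datasetKernel P.data s.Dh))
          i) ≤ 67 / 36 * (49 / 18 * ‖gradient (P.f i) w‖ ^ 2
            + (σt ^ 2 / (18 * s.Din) + σt ^ 2 / s.Do)) := by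
  have hαL' := mul_le_sixth hL hαL
  rw [Kernel.prod_apply, Kernel.prod_apply]
  set μ := datasetKernel P.data s.Din i
  set ν := (datasetKernel P.data s.Do i).prod (datasetKernel P.data s.Dh i)
  set g := gradient (P.f i) w
  have hmeas : Measurable fun D => P.taskDirection (s := s) α w (i, D) :=
    hA.measurable_taskDirection measurable_const (measurable_const.prodMk measurable_id)
  have hb := fun D : Fin s.Din → Θ =>
    hA.memLp_outer_direction hL hα hαL i w (w - α • P.batchGrad i w D) h2 h3 hH
  have hgr := hA.memLp_batchGrad i w s.Din
  have hgr' : MemLp (fun D => P.batchGrad i w D - g) 2 μ := hgr.sub (memLp_const g)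
  have hsq := hgr'.integrable_norm_pow two_ne_zero
  -- the gradient at the stochastic adapted point
  have hdiff : ∀ D : Fin s.Din → Θ,
      ‖gradient (P.f i) (w - α • P.batchGrad i w D) - gradient (P.f i) (w - α • g)‖
        ≤ 1 / 6 * ‖P.batchGrad i w D - g‖ := by
    intro D
    refine (hA.grad_lipschitz i _ _).trans ?_
    rw [sub_sub_sub_cancel_left, ← smul_sub, norm_smul, Real.norm_of_nonneg hα.le, norm_sub_rev]
    nlinarith [norm_nonneg (P.batchGrad i w D - g)]
  -- The gradient norm is at most 7/6 ‖g‖ plus 1/6 of the sampling error; (x + y)² ≤ 2x² + 2y² gives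
  -- 49/18 and 1/18.
  have hu : ∀ D : Fin s.Din → Θ, 67 / 36 * (‖gradient (P.f i) (w - α • P.batchGrad i w D)‖ ^ 2
      + σt ^ 2 / s.Do) ≤ 67 / 36 * (49 / 18 * ‖g‖ ^ 2 + (1 / 18 * ‖P.batchGrad i w D - g‖ ^ 2
        + σt ^ 2 / s.Do)) := by
    intro D
    have e1 := hdiff D
    have e2 := norm_gradient_adapted_le hL hα hαL (hA.grad_lipschitz i) w
    have e3 := norm_sub_norm_le (gradient (P.f i) (w - α • P.batchGrad i w D))
      (gradient (P.f i) (w - α • g))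
    have e4 : ‖gradient (P.f i) (w - α • P.batchGrad i w D)‖
        ≤ 7 / 6 * ‖g‖ + 1 / 6 * ‖P.batchGrad i w D - g‖ := by linarith
    have e5 := pow_le_pow_left₀ (norm_nonneg _) e4 2
    nlinarith [sq_nonneg (7 / 6 * ‖g‖ - 1 / 6 * ‖P.batchGrad i w D - g‖)]
  have h := memLp_prod (μ := μ) (ν := ν) hmeas (fun D => (hb D).1)
    (fun D => (hb D).2.2.trans (hu D))
    (((integrable_const _).add ((hsq.const_mul _).add (integrable_const _))).const_mul _)
  have hi := h.1.integrable one_le_two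
  refine ⟨h.1, ?_, h.2.trans ?_⟩
  · have e : ∫ D, P.taskDirection (s := s) α w (i, D) ∂(μ.prod ν) - adaptedGrad (P.f i) α w
        = ∫ D, ((∫ D', P.taskDirection (s := s) α w (i, D, D') ∂ν) - adaptedGrad (P.f i) α w)
          ∂μ := by
      rw [integral_sub hi.integral_prod_left (integrable_const _), integral_prod _ hi]
      simp
    rw [e]
    -- Averaging over the other two datasets leaves only the displacement of the adapted point as
    -- bias: 7/36 = 7/6 · 1/6.
    have hb1 : ∀ D, ‖(∫ D', P.taskDirection (s := s) α w (i, D, D') ∂ν)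
        - adaptedGrad (P.f i) α w‖ ≤ 7 / 36 * ‖P.batchGrad i w D - g‖ := by
      intro D
      have e1 : (∫ D', P.taskDirection (s := s) α w (i, D, D') ∂ν)
          = gradient (P.f i) (w - α • P.batchGrad i w D)
            - α • hessian (P.f i) w (gradient (P.f i) (w - α • P.batchGrad i w D)) :=
        (hb D).2.1
      have e2 := norm_sub_smul_hessian_le (hA.contDiff i) hL hα hαL (hA.grad_lipschitz i) w
        (gradient (P.f i) (w - α • P.batchGrad i w D) - gradient (P.f i) (w - α • g))
      have e3 : (∫ D', P.taskDirection (s := s) α w (i, D, D') ∂ν) - adaptedGrad (P.f i) α w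
          = (gradient (P.f i) (w - α • P.batchGrad i w D) - gradient (P.f i) (w - α • g))
            - α • hessian (P.f i) w (gradient (P.f i) (w - α • P.batchGrad i w D)
              - gradient (P.f i) (w - α • g)) := by
        rw [e1, adaptedGrad, map_sub, smul_sub]
        abel
      rw [e3]
      linarith [hdiff D]
    refine (norm_integral_le_of_norm_le ((hgr'.integrable one_le_two).norm.const_mul (7 / 36))
      (Filter.Eventually.of_forall hb1)).trans ?_
    rw [integral_const_mul]
    gcongr
    exact hA.integral_norm_batchGrad_sub_le hσt i w h1
  · have hsq' : Integrable (fun D => 1 / 18 * ‖P.batchGrad i w D - g‖ ^ 2 + σt ^ 2 / s.Do) μ :=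
      (hsq.const_mul _).add (integrable_const _)
    rw [integral_const_mul, integral_add (integrable_const _) hsq', integral_add (hsq.const_mul _)
      (integrable_const _), integral_const_mul]
    simp only [integral_const, probReal_univ, one_smul]
    have := hA.integral_norm_sq_batchGrad_sub_le i w h1
    have e : σt ^ 2 / (18 * s.Din) = 1 / 18 * (σt ^ 2 / s.Din) := by ring
    rw [e, integral_const_mul (1 / 18 : ℝ)]
    gcongr

/-- Moments of the contribution of one task to the stochastic direction. -/
lemma memLp_taskDirection (hσ : 0 ≤ σ) (hσt : 0 ≤ σt) (w : Vec d) {s : BatchSizes}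
    (h1 : 1 ≤ s.Din) (h2 : 1 ≤ s.Do) (h3 : 1 ≤ s.Dh) (hH : 2 * α ^ 2 * σH ^ 2 ≤ s.Dh) :
    MemLp (P.taskDirection (s := s) α w) 2 (P.outerLaw s) ∧
      ‖∫ x, P.taskDirection α w x ∂(P.outerLaw s) - P.metaGrad α w‖ ≤ 7 / 36 * (σt / √s.Din) ∧
      ∫ x, ‖P.taskDirection α w x‖ ^ 2 ∂(P.outerLaw s)
        ≤ 26 * ‖P.metaGrad α w‖ ^ 2 + 11 * σ ^ 2 + σt ^ 2 / s.Din + 2 * (σt ^ 2 / s.Do) := by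
  have hmeas : Measurable (P.taskDirection (s := s) α w) :=
    hA.measurable_taskDirection measurable_const measurable_id
  have hb := fun i => hA.memLp_task_direction hL hα hαL hσt i w h1 h2 h3 hH
  have hsq := (hA.memLp_gradient w).integrable_norm_pow two_ne_zero
  have h := memLp_compProd (μ := P.p) hmeas (fun i => (hb i).1) (fun i => (hb i).2.2)
    (((hsq.const_mul _).add (integrable_const _)).const_mul _)
  have hi := h.1.integrable one_le_two
  refine ⟨h.1, ?_, h.2.trans ?_⟩
  · have hi' : Integrable (fun i => ∫ D, P.taskDirection (s := s) α w (i, D)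
        ∂((datasetKernel P.data s.Din ×ₖ (datasetKernel P.data s.Do ×ₖ datasetKernel P.data s.Dh))
          i)) P.p := hi.integral_compProd
    rw [outerLaw, Measure.integral_compProd hi, metaGrad, ← integral_sub hi'
      (hA.integrable_adaptedGrad hL hα hαL w)]
    refine (norm_integral_le_of_norm_le (integrable_const _)
      (Filter.Eventually.of_forall fun i => (hb i).2.1)).trans ?_
    simp
  · rw [integral_const_mul, integral_add (hsq.const_mul _) (integrable_const _),
      integral_const_mul]
    simp only [integral_const, probReal_univ, one_smul]
    have e := hA.integral_norm_sq_gradient_le_metaGrad hL hα hαL hσ w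
    have e1 : σt ^ 2 / (18 * s.Din) = 1 / 18 * (σt ^ 2 / s.Din) := by ring
    have e2 : 0 ≤ σt ^ 2 / s.Din := by positivity
    have e3 : 0 ≤ σt ^ 2 / s.Do := by positivity
    rw [e1]
    nlinarith [sq_nonneg σ, sq_nonneg ‖P.metaGrad α w‖]

/-- The average direction of the batch of tasks: its mean and its second moment. -/
lemma memLp_average_taskDirection (hσ : 0 ≤ σ) (hσt : 0 ≤ σt) (w : Vec d) {s : BatchSizes}
    (h1 : 1 ≤ s.Din) (h2 : 1 ≤ s.Do) (h3 : 1 ≤ s.Dh) (hH : 2 * α ^ 2 * σH ^ 2 ≤ s.Dh)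
    (hB : 20 ≤ s.B) {N : ℝ}
    (hN : σ ^ 2 / s.B + σt ^ 2 / s.Din + σt ^ 2 / (s.B * s.Do) ≤ N) :
    MemLp (fun x : Fin s.B → OuterDraw ι Θ s => (s.B : ℝ)⁻¹ • ∑ b, P.taskDirection α w (x b)) 2
        (Measure.pi fun _ => P.outerLaw s) ∧
      ‖P.metaGrad α w‖ ^ 2 / 2 - N / 2 ≤
        inner ℝ (P.metaGrad α w) (∫ x : Fin s.B → OuterDraw ι Θ s,
          (s.B : ℝ)⁻¹ • ∑ b, P.taskDirection α w (x b) ∂(Measure.pi fun _ => P.outerLaw s)) ∧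
      ∫ x : Fin s.B → OuterDraw ι Θ s, ‖(s.B : ℝ)⁻¹ • ∑ b, P.taskDirection α w (x b)‖ ^ 2
        ∂(Measure.pi fun _ => P.outerLaw s) ≤ 33 / 10 * ‖P.metaGrad α w‖ ^ 2 + 11 * N := by
  obtain ⟨a1, a2, a3⟩ := hA.memLp_taskDirection hL hα hαL hσ hσt w h1 h2 h3 hH
  have hB1 : 1 ≤ s.B := by omega
  have hB0 : (0 : ℝ) < s.B := by positivity
  have hmeas : Measurable (P.taskDirection (s := s) α w) :=
    hA.measurable_taskDirection measurable_const measurable_id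
  have hmean := integral_average (a1.integrable one_le_two) hB1
  have hvar := integral_norm_sq_average_sub hmeas a1 hB1
  have hav := memLp_average a1 s.B
  have hdec := integral_norm_sq_eq_add hav 0
  have hdec1 := integral_norm_sq_eq_add a1 0
  rw [hmean] at hdec
  set m := ∫ x, P.taskDirection α w x ∂(P.outerLaw s)
  simp only [sub_zero] at hdec hdec1
  set G := P.metaGrad α w
  have hr : ‖m - G‖ ^ 2 ≤ 49 / 1296 * (σt ^ 2 / s.Din) := by
    have := pow_le_pow_left₀ (norm_nonneg _) a2 2
    rw [mul_pow, div_pow σt, Real.sq_sqrt (by positivity)] at this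
    linarith
  have e1 : 0 ≤ σt ^ 2 / s.Din := by positivity
  have e2 : 0 ≤ σ ^ 2 / s.B := by positivity
  have e3 : 0 ≤ σt ^ 2 / (s.B * s.Do) := by positivity
  have hin : inner ℝ G m = ‖G‖ ^ 2 + inner ℝ G (m - G) := by
    rw [inner_sub_right, real_inner_self_eq_norm_sq]; ring
  have hcs := neg_le_of_abs_le (abs_real_inner_le_norm G (m - G))
  refine ⟨hav, ?_, ?_⟩
  · rw [hmean, hin]
    -- Young's inequality applied to ‖G‖ ‖m − G‖; the squared bias is below N.
    nlinarith [sq_nonneg (‖G‖ - ‖m - G‖)]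
  · rw [hdec, hvar]
    have hm2 : ‖m‖ ^ 2 ≤ 2 * ‖G‖ ^ 2 + 2 * ‖m - G‖ ^ 2 := by
      have := norm_add_le G (m - G)
      rw [add_sub_cancel] at this
      have := pow_le_pow_left₀ (norm_nonneg _) this 2
      nlinarith [sq_nonneg (‖G‖ - ‖m - G‖)]
    -- Here 20 ≤ B matters: the variance contributes 26/20 ‖G‖² and the squared mean 2‖G‖², together
    -- 33/10.
    have hv : (∫ x, ‖P.taskDirection α w x - m‖ ^ 2 ∂(P.outerLaw s)) / s.B
        ≤ 26 / 20 * ‖G‖ ^ 2 + 11 * (σ ^ 2 / s.B) + σt ^ 2 / s.Din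
          + 2 * (σt ^ 2 / (s.B * s.Do)) := by
      have hB20 : (20 : ℝ) ≤ s.B := by exact_mod_cast hB
      have c1 : ‖G‖ ^ 2 / s.B ≤ ‖G‖ ^ 2 / 20 := by gcongr
      have c2 : σt ^ 2 / s.Din / s.B ≤ σt ^ 2 / s.Din := div_le_self e1 (by linarith)
      have c3 : (∫ x, ‖P.taskDirection α w x - m‖ ^ 2 ∂(P.outerLaw s)) / s.B
        ≤ (26 * ‖G‖ ^ 2 + 11 * σ ^ 2 + σt ^ 2 / s.Din + 2 * (σt ^ 2 / s.Do)) / s.B := by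
        gcongr
        nlinarith [sq_nonneg ‖m‖]
      have c4 : (26 * ‖G‖ ^ 2 + 11 * σ ^ 2 + σt ^ 2 / s.Din + 2 * (σt ^ 2 / s.Do)) / s.B
          = 26 * (‖G‖ ^ 2 / s.B) + 11 * (σ ^ 2 / s.B) + σt ^ 2 / s.Din / s.B
            + 2 * (σt ^ 2 / (s.B * s.Do)) := by
        field_simp
      linarith
    linarith

end Assumptions

end Problem

/-! ### The stochastic stepsize as an estimate of the reciprocal smoothness. -/

/-- The first two moments of the reciprocal of `a + c H` for a nonnegative random variable `H` whose
variance is controlled by `a`. -/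
lemma reciprocal_moments {Ω : Type*} [MeasurableSpace Ω] {μ : Measure Ω} [IsProbabilityMeasure μ]
    {H : Ω → ℝ} {a c m : ℝ} (hm : MemLp H 2 μ) (hH : ∀ x, 0 ≤ H x) (ha : 0 < a) (hc : 0 ≤ c)
    (hmean : ∫ x, H x ∂μ = m) (hvar : c ^ 2 * ∫ x, ‖H x - m‖ ^ 2 ∂μ ≤ 9 / 16 * a ^ 2) :
    1 / (a + c * m) ≤ ∫ x, 1 / (a + c * H x) ∂μ ∧
      ∫ x, (1 / (a + c * H x)) ^ 2 ∂μ ≤ 25 / 8 / (a + c * m) ^ 2 := by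
  have hY : ∀ x, a ≤ a + c * H x := fun x => by
    have := mul_nonneg hc (hH x)
    linarith
  have hm0 : 0 ≤ m := hmean ▸ integral_nonneg hH
  set M := a + c * m with hM
  have hM0 : 0 < M := by positivity
  have hHi : Integrable H μ := hm.integrable one_le_two
  have i1 : Integrable (fun x => c * H x) μ := hHi.const_mul _
  have i2 : Integrable (fun x => a + c * H x) μ := (integrable_const _).add i1
  have hbm : AEStronglyMeasurable (fun x => 1 / (a + c * H x)) μ :=
    (i2.aemeasurable.const_div 1).aestronglyMeasurable
  have hbl : ∀ x, 0 ≤ 1 / (a + c * H x) ∧ 1 / (a + c * H x) ≤ 1 / a := fun x =>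
    ⟨one_div_nonneg.2 (ha.le.trans (hY x)), one_div_le_one_div_of_le ha (hY x)⟩
  have hbi : Integrable (fun x => 1 / (a + c * H x)) μ :=
    (integrable_const (1 / a)).mono' hbm (Filter.Eventually.of_forall fun x => by
        rw [Real.norm_of_nonneg (hbl x).1]; exact (hbl x).2)
  have hbi2 : Integrable (fun x => (1 / (a + c * H x)) ^ 2) μ :=
    (integrable_const ((1 / a) ^ 2)).mono' (hbm.pow 2)
      (Filter.Eventually.of_forall fun x => by
        rw [Real.norm_of_nonneg (sq_nonneg _)]
        exact pow_le_pow_left₀ (hbl x).1 (hbl x).2 2)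
  constructor
  -- Jensen by hand: the convex function 1/y lies above its tangent at M, and the tangent integrates
  -- to 1/M.
  · have h1 : ∫ x, (2 / M - (a + c * H x) / M ^ 2) ∂μ ≤ ∫ x, 1 / (a + c * H x) ∂μ := by
      refine integral_mono ((integrable_const _).sub (i2.div_const _)) hbi fun x => ?_
      change 2 / M - (a + c * H x) / M ^ 2 ≤ 1 / (a + c * H x)
      have hy := ha.trans_le (hY x)
      set y := a + c * H x
      have : 1 / y - (2 / M - y / M ^ 2) = (M - y) ^ 2 / (y * M ^ 2) := by
        field_simp
        ring
      have : 0 ≤ (M - y) ^ 2 / (y * M ^ 2) := by positivity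
      linarith
    refine le_trans (le_of_eq ?_) h1
    rw [integral_sub (integrable_const _) (i2.div_const _), integral_div (M ^ 2),
      integral_add (integrable_const _) i1, integral_const_mul, hmean]
    simp only [integral_const, probReal_univ, one_smul]
    rw [← hM]
    field_simp
    ring
  · have hvi := (hm.sub (memLp_const m)).integrable_norm_pow two_ne_zero
    simp only [Pi.sub_apply] at hvi
    set K := 2 * c ^ 2 / (a ^ 2 * M ^ 2) with hK
    have h1 : ∫ x, (1 / (a + c * H x)) ^ 2 ∂μ
        ≤ ∫ x, (2 / M ^ 2 + K * ‖H x - m‖ ^ 2) ∂μ := by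
      refine integral_mono hbi2 ((integrable_const _).add (hvi.const_mul _)) fun x => ?_
      change (1 / (a + c * H x)) ^ 2 ≤ 2 / M ^ 2 + K * ‖H x - m‖ ^ 2
      rw [Real.norm_eq_abs, sq_abs]
      have hya := hY x
      have e2 : K * (H x - m) ^ 2 = 2 * (M - (a + c * H x)) ^ 2 / (a ^ 2 * M ^ 2) := by
        rw [hK, hM]; ring
      rw [e2]
      set y := a + c * H x
      have hy : 0 < y := ha.trans_le hya
      -- Division by y² M² bounds 1/y² by 2/M² plus a deviation term, in which y is replaced by its
      -- lower bound a. The variance hypothesis then gives 2 + 2 · 9/16 = 25/8.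
      have h3 : M ^ 2 ≤ 2 * y ^ 2 + 2 * (M - y) ^ 2 := by nlinarith [sq_nonneg (M - 2 * y)]
      have h4 : 2 * (M - y) ^ 2 / (y ^ 2 * M ^ 2) ≤ 2 * (M - y) ^ 2 / (a ^ 2 * M ^ 2) := by
        gcongr
      have h5 : (1 / y) ^ 2 ≤ 2 / M ^ 2 + 2 * (M - y) ^ 2 / (y ^ 2 * M ^ 2) := by
        have e3 : 2 / M ^ 2 + 2 * (M - y) ^ 2 / (y ^ 2 * M ^ 2)
            = (2 * y ^ 2 + 2 * (M - y) ^ 2) / (y ^ 2 * M ^ 2) := by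
          field_simp
        have e4 : (1 / y) ^ 2 = M ^ 2 / (y ^ 2 * M ^ 2) := by field_simp
        rw [e3, e4]
        gcongr
      linarith
    rw [integral_add (integrable_const _) (hvi.const_mul _), integral_const_mul] at h1
    simp only [integral_const, probReal_univ, one_smul] at h1
    refine h1.trans ?_
    have e : K * ∫ x, ‖H x - m‖ ^ 2 ∂μ
        = 2 * (c ^ 2 * ∫ x, ‖H x - m‖ ^ 2 ∂μ) / (a ^ 2 * M ^ 2) := by rw [hK]; ring
    rw [e]
    calc _ ≤ 2 / M ^ 2 + 2 * (9 / 16 * a ^ 2) / (a ^ 2 * M ^ 2) := by gcongr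
      _ = 25 / 8 / M ^ 2 := by field_simp; norm_num

namespace Problem

variable {d : ℕ} {ι Θ : Type*} [MeasurableSpace ι] [MeasurableSpace Θ] {P : Problem d ι Θ}
  {L ρ α σ σt σH : ℝ}

lemma betaTilde_pos_le (hL : 0 < L) (hα : 0 < α) (hρ : 0 ≤ ρ) {s : BatchSizes} (w : Vec d)
    (x : Fin s.B' → StepsizeDraw ι Θ s) :
    0 < P.betaTilde s L ρ α w x ∧ P.betaTilde s L ρ α w x ≤ 1 / (4 * L) := by
  have h : 0 ≤ 2 * ρ * α / s.B' * ∑ j, ‖P.batchGrad (x j).1 w (x j).2‖ := by positivity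
  unfold betaTilde
  constructor
  · positivity
  · gcongr
    linarith

namespace Assumptions

variable (hA : P.Assumptions L ρ α σ σt σH)
include hA

lemma measurable_betaTilde {γ : Type*} [MeasurableSpace γ] {s : BatchSizes} {w : γ → Vec d}
    {x : γ → Fin s.B' → StepsizeDraw ι Θ s} (hw : Measurable w) (hx : Measurable x) :
    Measurable fun y => P.betaTilde s L ρ α (w y) (x y) := by
  have h : Measurable fun y => ∑ j, ‖P.batchGrad (x y j).1 (w y) (x y j).2‖ :=
    Finset.measurable_fun_sum _ fun j _ =>
      (hA.measurable_batchGrad ((measurable_pi_apply j).comp hx).fst hw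
        ((measurable_pi_apply j).comp hx).snd).norm
  exact ((h.const_mul _).const_add _).const_div _

/-- Moments of the stochastic gradient of a random task. -/
lemma memLp_stepsizeDraw (hσt : 0 ≤ σt) (w : Vec d) {s : BatchSizes} (hD : 1 ≤ s.Dβ) :
    MemLp (fun y : StepsizeDraw ι Θ s => P.batchGrad y.1 w y.2) 2 (P.stepsizeLaw s) ∧
      ∫ i, ‖gradient (P.f i) w‖ ∂P.p
        ≤ ∫ y : StepsizeDraw ι Θ s, ‖P.batchGrad y.1 w y.2‖ ∂(P.stepsizeLaw s) ∧
      ∫ y : StepsizeDraw ι Θ s, ‖P.batchGrad y.1 w y.2‖ ∂(P.stepsizeLaw s)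
        ≤ ∫ i, ‖gradient (P.f i) w‖ ∂P.p + σt / √s.Dβ ∧
      ∫ y : StepsizeDraw ι Θ s, ‖P.batchGrad y.1 w y.2 - P.meanGrad w‖ ^ 2 ∂(P.stepsizeLaw s)
        ≤ σ ^ 2 + σt ^ 2 / s.Dβ := by
  have hmeas : Measurable (fun y : StepsizeDraw ι Θ s => P.batchGrad y.1 w y.2) :=
    hA.measurable_batchGrad measurable_fst measurable_const measurable_snd
  have hg := hA.integrable_gradient w
  have hgs := (hA.memLp_gradient_sub w).1.integrable_norm_pow two_ne_zero
  have hfib := fun i => hA.memLp_batchGrad i w s.Dβ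
  have h := memLp_compProd (μ := P.p) (κ := datasetKernel P.data s.Dβ)
    (f := fun y : StepsizeDraw ι Θ s => P.batchGrad y.1 w y.2 - P.meanGrad w)
    (u := fun i => ‖gradient (P.f i) w - P.meanGrad w‖ ^ 2 + σt ^ 2 / s.Dβ)
    (hmeas.sub_const _) (fun i => (hfib i).sub (memLp_const _)) (fun i => ?_)
    (hgs.add (integrable_const _))
  · have hm : MemLp (fun y : StepsizeDraw ι Θ s => P.batchGrad y.1 w y.2) 2 (P.stepsizeLaw s) := by
      refine (h.1.add (memLp_const (P.meanGrad w))).congr_norm hmeas.aestronglyMeasurable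
        (Filter.Eventually.of_forall fun θ => ?_)
      simp
    have hi := (hm.integrable one_le_two).norm
    have e : ∫ y : StepsizeDraw ι Θ s, ‖P.batchGrad y.1 w y.2‖ ∂(P.stepsizeLaw s)
        = ∫ i, ∫ D, ‖P.batchGrad i w D‖ ∂(datasetKernel P.data s.Dβ i) ∂P.p :=
      Measure.integral_compProd hi
    have hi' : Integrable (fun i => ∫ D, ‖P.batchGrad i w D‖ ∂(datasetKernel P.data s.Dβ i))
      P.p := hi.integral_compProd
    refine ⟨hm, ?_, ?_, ?_⟩
    · rw [e]
      refine integral_mono hg.norm hi' fun i => ?_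
      change ‖gradient (P.f i) w‖ ≤ _
      rw [← hA.integral_batchGrad i w hD]
      exact norm_integral_le_integral_norm _
    · rw [e]
      have e2 : ∫ i, ‖gradient (P.f i) w‖ ∂P.p + σt / √s.Dβ
          = ∫ i, (‖gradient (P.f i) w‖ + σt / √s.Dβ) ∂P.p := by
        rw [integral_add hg.norm (integrable_const _)]
        simp
      rw [e2]
      refine integral_mono hi' (hg.norm.add (integrable_const _)) fun i => ?_
      have hj := (hfib i).integrable one_le_two
      have hk : Integrable (fun D => ‖P.batchGrad i w D - gradient (P.f i) w‖)
        (datasetKernel P.data s.Dβ i) := (hj.sub (integrable_const _)).norm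
      calc ∫ D, ‖P.batchGrad i w D‖ ∂(datasetKernel P.data s.Dβ i)
          ≤ ∫ D, (‖gradient (P.f i) w‖ + ‖P.batchGrad i w D - gradient (P.f i) w‖)
            ∂(datasetKernel P.data s.Dβ i) :=
            integral_mono hj.norm ((integrable_const _).add hk)
              fun D => norm_le_norm_add_norm_sub' _ _
        _ ≤ _ := by
            rw [integral_add (integrable_const _) hk]
            simp only [integral_const, probReal_univ, one_smul]
            gcongr
            exact hA.integral_norm_batchGrad_sub_le hσt i w hD
    · refine h.2.trans ?_
      rw [integral_add hgs (integrable_const _)]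
      simp only [integral_const, probReal_univ, one_smul]
      gcongr
      exact (hA.memLp_gradient_sub w).2
  · have := integral_norm_sq_eq_add (hfib i) (P.meanGrad w)
    simp only [hA.integral_batchGrad i w hD] at this
    change ∫ D, ‖P.batchGrad i w D - P.meanGrad w‖ ^ 2 ∂(datasetKernel P.data s.Dβ i) ≤ _
    rw [this]
    linarith [hA.integral_norm_sq_batchGrad_sub_le i w hD]

/-- The moments of the stochastic stepsize. -/
lemma betaTilde_moments (hL : 0 < L) (hα : 0 < α) (hρ : 0 ≤ ρ) (hσt : 0 ≤ σt) (w : Vec d)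
    {s : BatchSizes} (hD : 1 ≤ s.Dβ) (hB : 1 ≤ s.B') (hB' : 0.5 * (ρ * α * σ / L) ^ 2 ≤ s.B')
    (hD' : (2 * ρ * α * σt / L) ^ 2 ≤ s.Dβ) :
    4 / 5 / P.smoothness L ρ α w
        ≤ ∫ x, P.betaTilde s L ρ α w x ∂(Measure.pi fun _ => P.stepsizeLaw s) ∧
      ∫ x, P.betaTilde s L ρ α w x ^ 2 ∂(Measure.pi fun _ => P.stepsizeLaw s)
        ≤ 25 / 8 / P.smoothness L ρ α w ^ 2 := by
  obtain ⟨a1, a2, a3, a4⟩ := hA.memLp_stepsizeDraw hσt w hD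
  have hmeas : Measurable (fun y : StepsizeDraw ι Θ s => ‖P.batchGrad y.1 w y.2‖) :=
    (hA.measurable_batchGrad measurable_fst measurable_const measurable_snd).norm
  have hm : MemLp (fun y : StepsizeDraw ι Θ s => ‖P.batchGrad y.1 w y.2‖) 2 (P.stepsizeLaw s) :=
    a1.norm
  have b1 := integral_average (hm.integrable one_le_two) hB
  have b2 := integral_norm_sq_average_sub hmeas hm hB
  have b3 := memLp_average hm s.B'
  set m := ∫ y : StepsizeDraw ι Θ s, ‖P.batchGrad y.1 w y.2‖ ∂(P.stepsizeLaw s)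
  set H : (Fin s.B' → StepsizeDraw ι Θ s) → ℝ :=
    fun x => (s.B' : ℝ)⁻¹ • ∑ j, ‖P.batchGrad (x j).1 w (x j).2‖ with hHdef
  set π := Measure.pi fun _ : Fin s.B' => P.stepsizeLaw s
  have hB0 : (0 : ℝ) < s.B' := by positivity
  have hD0 : (0 : ℝ) < s.Dβ := by positivity
  have b4 : ∫ x, ‖H x - m‖ ^ 2 ∂π ≤ (σ ^ 2 + σt ^ 2 / s.Dβ) / s.B' := by
    rw [b2]
    gcongr
    refine le_trans ?_ a4
    have := integral_norm_sq_eq_add hm ‖P.meanGrad w‖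
    -- The variance of the norm is at most its second moment about ‖E∇f_i(w)‖, and taking norms does
    -- not increase distances.
    refine le_trans (b := ∫ y : StepsizeDraw ι Θ s,
      ‖‖P.batchGrad y.1 w y.2‖ - ‖P.meanGrad w‖‖ ^ 2 ∂(P.stepsizeLaw s)) ?_ ?_
    · rw [this]
      exact le_add_of_nonneg_right (sq_nonneg _)
    · refine integral_mono
        ((hm.sub (memLp_const ‖P.meanGrad w‖)).integrable_norm_pow two_ne_zero)
        ((a1.sub (memLp_const (P.meanGrad w))).integrable_norm_pow two_ne_zero) fun y => ?_
      change ‖‖P.batchGrad y.1 w y.2‖ - ‖P.meanGrad w‖‖ ^ 2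
        ≤ ‖P.batchGrad y.1 w y.2 - P.meanGrad w‖ ^ 2
      gcongr
      exact abs_norm_sub_norm_le _ _
  have hβ : ∀ x, P.betaTilde s L ρ α w x = 1 / (4 * L + 2 * ρ * α * H x) := by
    intro x
    simp only [betaTilde, hHdef, smul_eq_mul]
    congr 2
    ring
  have hH0 : ∀ x, 0 ≤ H x := fun x => by
    simp only [hHdef, smul_eq_mul]; positivity
  have hm0 : 0 ≤ m := integral_nonneg fun _ => norm_nonneg _
  set M := 4 * L + 2 * ρ * α * m with hM
  have hM0 : 0 < M := by positivity
  have hSM : P.smoothness L ρ α w ≤ M := by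
    have : 0 ≤ 2 * ρ * α := by positivity
    have := mul_le_mul_of_nonneg_left a2 this
    unfold smoothness
    linarith
  have hS4 : 4 * L ≤ P.smoothness L ρ α w := le_smoothness hα.le hρ w
  have hS0 : 0 < P.smoothness L ρ α w := by linarith
  -- Sampling noise inflates the mean of the norm; the size of D_β caps the effect at L, which is at
  -- most a quarter of the smoothness.
  have hMS : M ≤ 5 / 4 * P.smoothness L ρ α w := by
    have h1 : 2 * ρ * α * (σt / √s.Dβ) ≤ L := by
      have h2 : 2 * ρ * α * σt / L ≤ √s.Dβ := by
        exact Real.le_sqrt_of_sq_le hD'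
      rw [div_le_iff₀ hL] at h2
      rw [← mul_div_assoc, div_le_iff₀ (by positivity)]
      linarith
    have h2 : 2 * ρ * α * m ≤ 2 * ρ * α * (∫ i, ‖gradient (P.f i) w‖ ∂P.p + σt / √s.Dβ) := by
      gcongr
    have h3 : M ≤ P.smoothness L ρ α w + L := by
      unfold smoothness
      linarith
    linarith
  -- The size of B' makes the task part at most 8L² and the size of D_β makes the data part at most
  -- L². The total 9L² equals 9/16 (4L)².
  have hvar : (2 * ρ * α) ^ 2 * ∫ x, ‖H x - m‖ ^ 2 ∂π ≤ 9 * L ^ 2 := by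
    have c1 : (ρ * α * σ) ^ 2 ≤ 2 * L ^ 2 * s.B' := by
      rw [div_pow, ← mul_div_assoc, div_le_iff₀ (by positivity)] at hB'
      linarith
    have c2 : (2 * ρ * α * σt) ^ 2 ≤ L ^ 2 * s.Dβ := by
      rw [div_pow, div_le_iff₀ (by positivity)] at hD'
      linarith
    have c3 := mul_le_mul_of_nonneg_left b4 (sq_nonneg (2 * ρ * α))
    refine c3.trans ?_
    have e : (2 * ρ * α) ^ 2 * ((σ ^ 2 + σt ^ 2 / s.Dβ) / s.B')
        = (4 * (ρ * α * σ) ^ 2 + (2 * ρ * α * σt) ^ 2 / s.Dβ) / s.B' := by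
      field_simp
      ring
    rw [e, div_le_iff₀ hB0]
    have c4 : (2 * ρ * α * σt) ^ 2 / s.Dβ ≤ L ^ 2 := by rwa [div_le_iff₀ hD0]
    have c5 : (1 : ℝ) ≤ s.B' := by exact_mod_cast hB
    nlinarith [sq_nonneg L]
  have h := reciprocal_moments b3 hH0 (a := 4 * L) (c := 2 * ρ * α) (by positivity)
    (by positivity) b1 (by linarith)
  rw [← hM] at h
  simp_rw [hβ]
  constructor
  · refine le_trans ?_ h.1
    rw [div_div, div_le_div_iff₀ (by positivity) hM0]
    linarith
  · refine h.2.trans ?_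
    gcongr

end Assumptions

end Problem

/-! ### Expected decrease of the objective in one step. -/

namespace Problem

variable {d : ℕ} {ι Θ : Type*} [MeasurableSpace ι] [MeasurableSpace Θ] {P : Problem d ι Θ}
  {L ρ α σ σt σH : ℝ}

lemma step_eq (P : Problem d ι Θ) (s : BatchSizes) (L ρ α : ℝ) (w : Vec d) (x : IterDraw ι Θ s) :
    P.step s L ρ α w x = w - (P.betaTilde s L ρ α w x.2 / 12) •
      ((s.B : ℝ)⁻¹ • ∑ b, P.taskDirection α w (x.1 b)) := by
  rw [step, smul_smul, div_eq_mul_inv _ (s.B : ℝ)]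

namespace Assumptions

variable (hA : P.Assumptions L ρ α σ σt σH)
include hA

lemma measurable_step {γ : Type*} [MeasurableSpace γ] {s : BatchSizes} {w : γ → Vec d}
    {x : γ → IterDraw ι Θ s} (hw : Measurable w) (hx : Measurable x) :
    Measurable fun y => P.step s L ρ α (w y) (x y) := by
  have h1 : Measurable fun y => ∑ b, P.taskDirection α (w y) ((x y).1 b) :=
    Finset.measurable_fun_sum _ fun b _ =>
      hA.measurable_taskDirection hw ((measurable_pi_apply b).comp hx.fst)
  have h2 := ((hA.measurable_betaTilde hw hx.snd).div_const 12).div_const (s.B : ℝ)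
  exact hw.sub (h2.smul h1)

/-- The expected decrease of the MAML objective in one step. -/
lemma integral_metaLoss_step_le (hL : 0 < L) (hα : 0 < α) (hαL : α ≤ 1 / (6 * L)) (hρ : 0 ≤ ρ)
    (hσ : 0 ≤ σ) (hσt : 0 ≤ σt) (w : Vec d) {s : BatchSizes}
    (h1 : 1 ≤ s.Din) (h2 : 1 ≤ s.Do) (h3 : 1 ≤ s.Dh) (h4 : 1 ≤ s.B') (h5 : 1 ≤ s.Dβ)
    (hH : 2 * α ^ 2 * σH ^ 2 ≤ s.Dh) (hB : 20 ≤ s.B) (hB' : 0.5 * (ρ * α * σ / L) ^ 2 ≤ s.B')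
    (hD' : (2 * ρ * α * σt / L) ^ 2 ≤ s.Dβ) {N : ℝ}
    (hN : σ ^ 2 / s.B + σt ^ 2 / s.Din + σt ^ 2 / (s.B * s.Do) ≤ N) :
    Integrable (fun x => P.metaLoss α (P.step s L ρ α w x)) (P.iterLaw s) ∧
      ∫ x, P.metaLoss α (P.step s L ρ α w x) ∂(P.iterLaw s) ≤ P.metaLoss α w
        - (‖P.metaGrad α w‖ ^ 2 / 100 - N / 5) / P.smoothness L ρ α w := by
  obtain ⟨a1, a2, a3⟩ := hA.memLp_average_taskDirection hL hα hαL hσ hσt w h1 h2 h3 hH hB hN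
  obtain ⟨b1, b2⟩ := hA.betaTilde_moments hL hα hρ hσt w h5 h4 hB' hD'
  have hN0 : 0 ≤ N := le_trans (by positivity) hN
  have hS0 : 0 < P.smoothness L ρ α w := by
    linarith [le_smoothness (P := P) (L := L) hα.le hρ w]
  set S := P.smoothness L ρ α w
  set G := P.metaGrad α w
  set π₁ := Measure.pi fun _ : Fin s.B => P.outerLaw s
  set π₂ := Measure.pi fun _ : Fin s.B' => P.stepsizeLaw s
  set D : (Fin s.B → OuterDraw ι Θ s) → Vec d :=
    fun x => (s.B : ℝ)⁻¹ • ∑ b, P.taskDirection α w (x b) with hD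
  set β : (Fin s.B' → StepsizeDraw ι Θ s) → ℝ := P.betaTilde s L ρ α w with hβ
  have hbm : Measurable β := hA.measurable_betaTilde measurable_const measurable_id
  have hbl : ∀ x, 0 < β x ∧ β x ≤ 1 / (4 * L) := fun x => betaTilde_pos_le hL hα hρ w x
  have hb2 : MemLp β 2 π₂ := MemLp.of_bound hbm.aestronglyMeasurable (1 / (4 * L))
    (Filter.Eventually.of_forall fun x => by
        rw [Real.norm_of_nonneg (hbl x).1.le]; exact (hbl x).2)
  have hbi := hb2.integrable one_le_two
  have hbi2 : Integrable (fun y => β y ^ 2) π₂ := hb2.integrable_sq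
  have hDi : Integrable (fun x => inner ℝ G (D x)) π₁ := (a1.integrable one_le_two).const_inner G
  have hD2 := a1.integrable_norm_pow two_ne_zero
  have hstep : ∀ x : IterDraw ι Θ s, P.metaLoss α (P.step s L ρ α w x)
      ≤ P.metaLoss α w - 1 / 12 * (inner ℝ G (D x.1) * β x.2)
        + 7 / 24 * S / 144 * (‖D x.1‖ ^ 2 * β x.2 ^ 2) := by
    intro x
    have := hA.metaLoss_le hL hα hαL w (P.step s L ρ α w x)
    rw [step_eq, sub_sub_cancel_left, inner_neg_right, inner_smul_right, norm_neg, norm_smul,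
      mul_pow, Real.norm_eq_abs, sq_abs] at this
    rw [step_eq]
    refine this.trans (le_of_eq ?_)
    change _ + -(β x.2 / 12 * inner ℝ G (D x.1)) + 7 / 24 * S * ((β x.2 / 12) ^ 2 * ‖D x.1‖ ^ 2)
      = _
    ring
  have i1 : Integrable (fun x : IterDraw ι Θ s => 1 / 12 * (inner ℝ G (D x.1) * β x.2))
      (P.iterLaw s) := (hDi.mul_prod hbi).const_mul _
  have i2 : Integrable (fun x : IterDraw ι Θ s =>
      7 / 24 * S / 144 * (‖D x.1‖ ^ 2 * β x.2 ^ 2)) (P.iterLaw s) :=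
    (hD2.mul_prod hbi2).const_mul _
  have i3 : Integrable (fun x : IterDraw ι Θ s =>
      P.metaLoss α w - 1 / 12 * (inner ℝ G (D x.1) * β x.2)) (P.iterLaw s) :=
    (integrable_const _).sub i1
  have i4 := i3.add i2
  have hmeas : Measurable fun x => P.metaLoss α (P.step s L ρ α w x) :=
    (hA.continuous_metaLoss hL hα hαL).measurable.comp
      (hA.measurable_step measurable_const measurable_id)
  -- The value after the step lies between the infimum of the objective and the integrable quadratic
  -- majorant.
  have hint : Integrable (fun x => P.metaLoss α (P.step s L ρ α w x)) (P.iterLaw s) := by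
    refine (i4.norm.add (integrable_const |⨅ u, P.metaLoss α u|)).mono' hmeas.aestronglyMeasurable
      (Filter.Eventually.of_forall fun x => ?_)
    simp only [Pi.add_apply, Real.norm_eq_abs]
    have e1 := hstep x
    have e2 := ciInf_le hA.bddBelow (P.step s L ρ α w x)
    rw [abs_le]
    constructor
    · linarith [neg_abs_le (⨅ u, P.metaLoss α u), abs_nonneg (P.metaLoss α w
        - 1 / 12 * (inner ℝ G (D x.1) * β x.2) + 7 / 24 * S / 144 * (‖D x.1‖ ^ 2 * β x.2 ^ 2))]
    · linarith [abs_nonneg (⨅ u, P.metaLoss α u), le_abs_self (P.metaLoss α w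
        - 1 / 12 * (inner ℝ G (D x.1) * β x.2) + 7 / 24 * S / 144 * (‖D x.1‖ ^ 2 * β x.2 ^ 2))]
  refine ⟨hint, (integral_mono hint i4 hstep).trans ?_⟩
  have j1 : ∫ x : IterDraw ι Θ s, inner ℝ G (D x.1) * β x.2 ∂(P.iterLaw s)
      = (∫ x, inner ℝ G (D x) ∂π₁) * ∫ y, β y ∂π₂ :=
    integral_prod_mul (fun x => inner ℝ G (D x)) β
  have j2 : ∫ x : IterDraw ι Θ s, ‖D x.1‖ ^ 2 * β x.2 ^ 2 ∂(P.iterLaw s)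
      = (∫ x, ‖D x‖ ^ 2 ∂π₁) * ∫ y, β y ^ 2 ∂π₂ :=
    integral_prod_mul (fun x => ‖D x‖ ^ 2) fun y => β y ^ 2
  rw [integral_inner (a1.integrable one_le_two)] at j1
  have k1 := sq_integral_norm_le hb2
  have k2 : ∫ y, ‖β y‖ ∂π₂ = ∫ y, β y ∂π₂ :=
    integral_congr_ae (Filter.Eventually.of_forall fun y => Real.norm_of_nonneg (hbl y).1.le)
  have k3 : ∫ y, ‖β y‖ ^ 2 ∂π₂ = ∫ y, β y ^ 2 ∂π₂ := by simp
  rw [k2, k3] at k1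
  have e : ∫ x : IterDraw ι Θ s, (P.metaLoss α w - 1 / 12 * (inner ℝ G (D x.1) * β x.2)
        + 7 / 24 * S / 144 * (‖D x.1‖ ^ 2 * β x.2 ^ 2)) ∂(P.iterLaw s)
      = P.metaLoss α w - 1 / 12 * (inner ℝ G (∫ x, D x ∂π₁) * ∫ y, β y ∂π₂)
        + 7 / 24 * S / 144 * ((∫ x, ‖D x‖ ^ 2 ∂π₁) * ∫ y, β y ^ 2 ∂π₂) := by
    rw [integral_add i3 i2, integral_sub (integrable_const _) i1, integral_const_mul,
      integral_const_mul (7 / 24 * S / 144), j1, j2]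
    simp
  change ∫ x : IterDraw ι Θ s, (P.metaLoss α w - 1 / 12 * (inner ℝ G (D x.1) * β x.2)
        + 7 / 24 * S / 144 * (‖D x.1‖ ^ 2 * β x.2 ^ 2)) ∂(P.iterLaw s) ≤ _
  rw [e]
  change 4 / 5 / S ≤ ∫ y, β y ∂π₂ at b1
  change ∫ y, β y ^ 2 ∂π₂ ≤ 25 / 8 / S ^ 2 at b2
  set m₁ := ∫ y, β y ∂π₂
  set m₂ := ∫ y, β y ^ 2 ∂π₂
  have l0 : 0 ≤ m₁ := le_trans (by positivity) b1
  -- An upper bound on the mean stepsize is also needed, since the noise N enters the inner product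
  -- with a negative sign. It follows from the second moment, as 25/8 ≤ 4.
  have l1 : m₁ ≤ 2 / S := by
    refine abs_le_of_sq_le_sq' ?_ (by positivity) |>.2
    calc m₁ ^ 2 ≤ m₂ := k1
      _ ≤ 25 / 8 / S ^ 2 := b2
      _ ≤ (2 / S) ^ 2 := by rw [div_pow]; gcongr; norm_num
  have l2 : (2 / 5 * ‖G‖ ^ 2 - N) / S ≤ inner ℝ G (∫ x, D x ∂π₁) * m₁ := by
    calc (2 / 5 * ‖G‖ ^ 2 - N) / S = ‖G‖ ^ 2 / 2 * (4 / 5 / S) - N / 2 * (2 / S) := by ring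
      _ ≤ ‖G‖ ^ 2 / 2 * m₁ - N / 2 * m₁ := by gcongr
      _ = (‖G‖ ^ 2 / 2 - N / 2) * m₁ := by ring
      _ ≤ _ := by gcongr
  have l3 : 7 / 24 * S / 144 * ((∫ x, ‖D x‖ ^ 2 ∂π₁) * m₂)
      ≤ (7 / 24 / 144 * (33 / 10 * ‖G‖ ^ 2 + 11 * N) * (25 / 8)) / S := by
    calc 7 / 24 * S / 144 * ((∫ x, ‖D x‖ ^ 2 ∂π₁) * m₂)
        ≤ 7 / 24 * S / 144 * ((33 / 10 * ‖G‖ ^ 2 + 11 * N) * (25 / 8 / S ^ 2)) := by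
          gcongr
      _ = _ := by field_simp
  -- The factor 1/12 in the stepsize makes the linear gain ‖G‖²/30 exceed the quadratic loss of
  -- about 0.021 ‖G‖² by more than ‖G‖²/100.
  have l4 : -(1 / 12) * ((2 / 5 * ‖G‖ ^ 2 - N) / S)
      + (7 / 24 / 144 * (33 / 10 * ‖G‖ ^ 2 + 11 * N) * (25 / 8)) / S
      ≤ - ((‖G‖ ^ 2 / 100 - N / 5) / S) := by
    rw [← mul_div_assoc, ← add_div, ← neg_div _ (‖G‖ ^ 2 / 100 - N / 5)]
    refine div_le_div_of_nonneg_right ?_ hS0.le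
    linarith [sq_nonneg ‖G‖]
  linarith

/-- The decrease of the MAML objective in one step, linearized in the norm of the gradient. -/
lemma integral_metaLoss_step_le_linear (hL : 0 < L) (hα : 0 < α) (hαL : α ≤ 1 / (6 * L))
    (hρ : 0 ≤ ρ) (hσ : 0 ≤ σ) (hσt : 0 ≤ σt) (w : Vec d) {s : BatchSizes}
    (h1 : 1 ≤ s.Din) (h2 : 1 ≤ s.Do) (h3 : 1 ≤ s.Dh) (h4 : 1 ≤ s.B') (h5 : 1 ≤ s.Dβ)
    (hH : 2 * α ^ 2 * σH ^ 2 ≤ s.Dh) (hB : 20 ≤ s.B) (hB' : 0.5 * (ρ * α * σ / L) ^ 2 ≤ s.B')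
    (hD' : (2 * ρ * α * σt / L) ^ 2 ≤ s.Dβ) {A a ε : ℝ} (ha : 0 ≤ a) (hε : 0 < ε) (hε1 : ε ≤ 1)
    (hA4 : 4 ≤ A) (hσa : σ ≤ a) (hρa : 4 + 4 * (ρ * α / L) * (1 + a) ≤ A)
    (hN : σ ^ 2 / s.B + σt ^ 2 / s.Din + σt ^ 2 / (s.B * s.Do) ≤ ε ^ 2 / (20 * A)) :
    Integrable (fun x => P.metaLoss α (P.step s L ρ α w x)) (P.iterLaw s) ∧
      ∫ x, P.metaLoss α (P.step s L ρ α w x) ∂(P.iterLaw s) ≤ P.metaLoss α w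
        - 3 * ε / (400 * A * L) * ‖P.metaGrad α w‖ + 2 * ε ^ 2 / (400 * A * L) := by
  obtain ⟨i, hi⟩ := hA.integral_metaLoss_step_le hL hα hαL hρ hσ hσt w h1 h2 h3 h4 h5 hH hB hB'
    hD' hN
  refine ⟨i, hi.trans ?_⟩
  have hS4 : 4 * L ≤ P.smoothness L ρ α w := le_smoothness hα.le hρ w
  have hX := norm_nonneg (P.metaGrad α w)
  have hSX : P.smoothness L ρ α w ≤ A * L * (1 + ‖P.metaGrad α w‖) := by
    have e1 := hA.integral_norm_gradient_le_metaGrad hL hα hαL hσ w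
    have e2 : 0 ≤ ρ * α / L := by positivity
    have e3 : 2 * ρ * α = 2 * (ρ * α / L) * L := by field_simp
    unfold smoothness
    rw [e3]
    set q := ρ * α / L
    set X := ‖P.metaGrad α w‖
    calc 4 * L + 2 * q * L * ∫ i, ‖gradient (P.f i) w‖ ∂P.p
        ≤ 4 * L + 2 * q * L * (2 * (X + σ)) := by gcongr
      _ = (4 + 4 * q * (X + σ)) * L := by ring
      _ ≤ (4 * (1 + X) + 4 * q * ((1 + a) * (1 + X))) * L := by
          have e4 : X + σ ≤ (1 + a) * (1 + X) := by nlinarith [mul_nonneg ha hX]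
          gcongr
          linarith
      _ = (4 + 4 * q * (1 + a)) * L * (1 + X) := by ring
      _ ≤ _ := by gcongr
  set S := P.smoothness L ρ α w
  set X := ‖P.metaGrad α w‖
  have hA0 : 0 < A := by linarith
  have hS0 : 0 < S := by linarith
  have t1 : (3 / 4 * ε * X - ε ^ 2 / 4) / (100 * A * L) ≤ X ^ 2 / 100 / S := by
    have e1 : X ^ 2 / 100 / (A * L * (1 + X)) ≤ X ^ 2 / 100 / S := by gcongr
    refine le_trans ?_ e1
    rw [div_div, div_le_div_iff₀ (by positivity) (by positivity)]
    -- Expanding (X − ε(1 + X)/2)² ≥ 0 gives X² ≥ εX(1 + X) − ε²(1 + X)²/4. One factor 1 + X of the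
    -- last square is split, and ε² ≤ ε absorbs its X part into a quarter of εX(1 + X).
    have e2 : (3 / 4 * ε * X - ε ^ 2 / 4) * (1 + X) ≤ X ^ 2 := by
      have e3 : 0 ≤ (X - ε / 2 * (1 + X)) ^ 2 := sq_nonneg _
      have e4 : 0 ≤ ε * (1 - ε) * X * (1 + X) :=
        mul_nonneg (mul_nonneg (mul_nonneg hε.le (by linarith)) hX) (by linarith)
      nlinarith
    have := mul_le_mul_of_nonneg_right e2 (by positivity : 0 ≤ 100 * A * L)
    nlinarith
  have t2 : ε ^ 2 / (20 * A) / 5 / S ≤ ε ^ 2 / (20 * A) / 5 / (4 * L) := by gcongr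
  have t3 : ε ^ 2 / (20 * A) / 5 / (4 * L) = ε ^ 2 / (400 * A * L) := by
    field_simp; norm_num
  have t4 : (3 / 4 * ε * X - ε ^ 2 / 4) / (100 * A * L)
      = 3 * ε / (400 * A * L) * X - ε ^ 2 / (400 * A * L) := by
    field_simp
    ring
  have t5 : 2 * ε ^ 2 / (400 * A * L) = ε ^ 2 / (400 * A * L) + ε ^ 2 / (400 * A * L) := by ring
  rw [sub_div]
  linarith

end Assumptions

end Problem

/-! ### Random recursions with a negative drift. -/

/-- One step of a random recursion whose drift is controlled by `ξ`. -/
lemma integral_drift_step {V S Ω : Type*} [MeasurableSpace V] [MeasurableSpace S]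
    [MeasurableSpace Ω] {μ : Measure Ω} [IsProbabilityMeasure μ] {ν : Measure S}
    [IsProbabilityMeasure ν] {step : V → S → V} (hstep : Measurable (Function.uncurry step))
    {Φ ξ : V → ℝ} (hΦ : Measurable Φ) (hξ : Measurable ξ) (hΦ0 : ∀ w, 0 ≤ Φ w) (hξ0 : ∀ w, 0 ≤ ξ w)
    {a b : ℝ} (ha : 0 < a)
    (hdrift : ∀ w, Integrable (fun x => Φ (step w x)) ν ∧
      ∫ x, Φ (step w x) ∂ν ≤ Φ w - a * ξ w + b)
    {W : Ω → V} {X : Ω → S} (hW : Measurable W) (hX : Measurable X) (hind : IndepFun W X μ)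
    (hlaw : μ.map X = ν) (hi : Integrable (fun ω => Φ (W ω)) μ) :
    Integrable (fun ω => ξ (W ω)) μ ∧ Integrable (fun ω => Φ (step (W ω) (X ω))) μ ∧
      ∫ ω, Φ (step (W ω) (X ω)) ∂μ ≤ ∫ ω, Φ (W ω) ∂μ - a * ∫ ω, ξ (W ω) ∂μ + b := by
  -- Nonnegativity of the potential after the step bounds ξ by the current potential, so
  -- integrability of ξ needs no separate hypothesis.
  have hb : ∀ w, a * ξ w ≤ Φ w + b := fun w => by
    have := (integral_nonneg fun x => hΦ0 (step w x)).trans (hdrift w).2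
    linarith
  have hξi : Integrable (fun ω => ξ (W ω)) μ := by
    refine ((hi.add (integrable_const b)).div_const a).mono' (hξ.comp hW).aestronglyMeasurable
      (Filter.Eventually.of_forall fun ω => ?_)
    rw [Real.norm_of_nonneg (hξ0 _), le_div_iff₀ ha, mul_comm]
    exact hb (W ω)
  have : IsProbabilityMeasure (μ.map W) := Measure.isProbabilityMeasure_map hW.aemeasurable
  have hjoint : μ.map (fun ω => (W ω, X ω)) = (μ.map W).prod ν := by
    rw [← hlaw]
    exact (indepFun_iff_map_prod_eq_prod_map_map hW.aemeasurable hX.aemeasurable).1 hind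
  have hm : Measurable fun z : V × S => Φ (step z.1 z.2) := hΦ.comp hstep
  have hiW : Integrable Φ (μ.map W) :=
    (integrable_map_measure hΦ.aestronglyMeasurable hW.aemeasurable).2 hi
  have hξW : Integrable ξ (μ.map W) :=
    (integrable_map_measure hξ.aestronglyMeasurable hW.aemeasurable).2 hξi
  have hbound : Integrable (fun w => Φ w - a * ξ w + b) (μ.map W) :=
    (hiW.sub (hξW.const_mul a)).add (integrable_const b)
  have hprod : Integrable (fun z : V × S => Φ (step z.1 z.2)) ((μ.map W).prod ν) := by
    refine (integrable_prod_iff hm.aestronglyMeasurable).2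
      ⟨Filter.Eventually.of_forall fun w => (hdrift w).1, ?_⟩
    refine hbound.mono' hm.norm.stronglyMeasurable.integral_prod_right'.aestronglyMeasurable
      (Filter.Eventually.of_forall fun w => ?_)
    rw [Real.norm_of_nonneg (integral_nonneg fun x => norm_nonneg _)]
    simp_rw [Real.norm_of_nonneg (hΦ0 _)]
    exact (hdrift w).2
  have hWX : Measurable fun ω => (W ω, X ω) := hW.prodMk hX
  refine ⟨hξi, ?_, ?_⟩
  · rw [← hjoint] at hprod
    exact (integrable_map_measure hm.aestronglyMeasurable hWX.aemeasurable).1 hprod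
  · have e1 : ∫ ω, Φ (step (W ω) (X ω)) ∂μ = ∫ z, Φ (step z.1 z.2) ∂((μ.map W).prod ν) := by
      rw [← hjoint, integral_map hWX.aemeasurable hm.aestronglyMeasurable]
    have e2 : ∫ ω, Φ (W ω) ∂μ = ∫ w, Φ w ∂(μ.map W) :=
      (integral_map hW.aemeasurable hΦ.aestronglyMeasurable).symm
    have e3 : ∫ ω, ξ (W ω) ∂μ = ∫ w, ξ w ∂(μ.map W) :=
      (integral_map hW.aemeasurable hξ.aestronglyMeasurable).symm
    rw [e1, e2, e3, integral_prod _ hprod]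
    refine (integral_mono hprod.integral_prod_left hbound fun w => (hdrift w).2).trans (le_of_eq ?_)
    have i1 : Integrable (fun w => Φ w - a * ξ w) (μ.map W) := hiW.sub (hξW.const_mul a)
    rw [integral_add i1 (integrable_const b), integral_sub hiW (hξW.const_mul a),
      integral_const_mul]
    simp

/-- A random recursion with negative drift as long as `E ξ > ε` reaches `E ξ ≤ ε`. -/
lemma exists_integral_le_of_drift {V S Ω : Type*} [MeasurableSpace V] [MeasurableSpace S]
    [MeasurableSpace Ω] {μ : Measure Ω} [IsProbabilityMeasure μ] {ν : Measure S}
    [IsProbabilityMeasure ν] {step : V → S → V} (hstep : Measurable (Function.uncurry step))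
    {Φ ξ : V → ℝ} (hΦ : Measurable Φ) (hξ : Measurable ξ) (hΦ0 : ∀ w, 0 ≤ Φ w) (hξ0 : ∀ w, 0 ≤ ξ w)
    {a b ε δ : ℝ} (ha : 0 < a) (hδ : 0 < δ) (hab : a * ε - b = δ)
    (hdrift : ∀ w, Integrable (fun x => Φ (step w x)) ν ∧
      ∫ x, Φ (step w x) ∂ν ≤ Φ w - a * ξ w + b)
    {X : ℕ → Ω → S} (hX : ∀ k, Measurable (X k)) (hind : iIndepFun X μ)
    (hlaw : ∀ k, μ.map (X k) = ν) {w₀ : V} {W : (ℕ → S) → ℕ → V} (hW0 : ∀ x, W x 0 = w₀)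
    (hW : ∀ x k, W x (k + 1) = step (W x k) (x k)) :
    ∃ k : ℕ, (k : ℝ) ≤ Φ w₀ / δ ∧ Measurable (fun ω => W (fun j => X j ω) k) ∧
      Integrable (fun ω => ξ (W (fun j => X j ω) k)) μ ∧
      ∫ ω, ξ (W (fun j => X j ω) k) ∂μ ≤ ε := by
  have hmeas : ∀ k, Measurable fun x => W x k := by
    intro k
    induction k with
    | zero => simp only [hW0]; exact measurable_const
    | succ k ih =>
      simp only [hW]
      exact hstep.comp (ih.prodMk (measurable_pi_apply k))
  -- The k-th iterate depends on the draws before k only, hence is independent of draw k.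
  have hcongr : ∀ k (x y : ℕ → S), (∀ j < k, x j = y j) → W x k = W y k := by
    intro k
    induction k with
    | zero => intro x y _; rw [hW0, hW0]
    | succ k ih =>
      intro x y h
      rw [hW, hW, ih x y fun j hj => h j (hj.trans k.lt_succ_self), h k k.lt_succ_self]
  have hXm : Measurable fun ω j => X j ω := measurable_pi_lambda _ hX
  have hindk : ∀ k, IndepFun (fun ω => W (fun j => X j ω) k) (X k) μ := by
    intro k
    obtain ⟨ω₀⟩ : Nonempty Ω := μ.nonempty_of_neZero
    have h := hind.indepFun_finset (Finset.range k) {k} (by simp) hX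
    -- The first k draws are extended to a full sequence by the fixed values at ω₀; these never
    -- influence the k-th iterate.
    let pad : (Finset.range k → S) → ℕ → S :=
      fun y j => if h : j ∈ Finset.range k then y ⟨j, h⟩ else X j ω₀
    have hpad : Measurable pad := by
      refine measurable_pi_lambda _ fun j => ?_
      by_cases hj : j ∈ Finset.range k
      · simp only [pad, hj, dite_true]; exact measurable_pi_apply _
      · simp only [pad, hj, dite_false]; exact measurable_const
    have h2 := h.comp ((hmeas k).comp hpad)
      (measurable_pi_apply (⟨k, Finset.mem_singleton_self k⟩ : ({k} : Finset ℕ)))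
    have e : (fun ω => W (fun j => X j ω) k)
        = ((fun x => W x k) ∘ pad) ∘ fun ω (j : Finset.range k) => X j ω := by
      ext1 ω
      refine hcongr k _ _ fun j hj => ?_
      simp [pad, hj]
    rw [e]
    exact h2
  have hone := fun k hi => integral_drift_step hstep hΦ hξ hΦ0 hξ0 ha hdrift
    ((hmeas k).comp hXm) (hX k) (hindk k) (hlaw k) hi
  have hint : ∀ k, Integrable (fun ω => Φ (W (fun j => X j ω) k)) μ := by
    intro k
    induction k with
    | zero => simp only [hW0]; exact integrable_const _
    | succ k ih =>
      simp only [hW]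
      exact (hone k ih).2.1
  by_contra! hcon
  -- If every k ≤ K failed, K + 1 decreases of δ each would exceed the initial potential and make
  -- the expected potential negative.
  set K := ⌊Φ w₀ / δ⌋₊
  have hK : (K : ℝ) ≤ Φ w₀ / δ := Nat.floor_le (div_nonneg (hΦ0 _) hδ.le)
  have hdec : ∀ k ≤ K + 1, ∫ ω, Φ (W (fun j => X j ω) k) ∂μ ≤ Φ w₀ - k * δ := by
    intro k
    induction k with
    | zero => simp [hW0]
    | succ k ih =>
      intro hk
      have h1 := ih (by omega)
      have hkK : (k : ℝ) ≤ Φ w₀ / δ := le_trans (by exact_mod_cast (by omega : k ≤ K)) hK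
      have h2 := hone k (hint k)
      have h3 := hcon k hkK ((hmeas k).comp hXm) h2.1
      simp only [hW]
      have h4 := h2.2.2
      have h5 := mul_lt_mul_of_pos_left h3 ha
      push_cast
      simp only [Function.comp_apply] at h4 h5
      linarith
  have h1 := hdec (K + 1) le_rfl
  have h2 : 0 ≤ ∫ ω, Φ (W (fun j => X j ω) (K + 1)) ∂μ := integral_nonneg fun ω => hΦ0 _
  have h3 : Φ w₀ / δ < K + 1 := Nat.lt_floor_add_one _
  rw [div_lt_iff₀ hδ] at h3
  push_cast at h1
  linarith

end MAML

end

/-! ### Choice of constants and conclusion. -/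

/-- `c₁`, `c₂` are the constants of the assumption `ρ α / L = O(1)`, `σ² + σ̃² = O(1)`; the
constants `C₁`, `C₂` and the hidden constant `C` of the iteration bound depend on them only. -/
theorem corollary1 (c₁ c₂ : ℝ) :
    ∃ C₁ C₂ C : ℝ, 0 < C₁ ∧ 0 < C₂ ∧ 0 < C ∧
      ∀ (d : ℕ) (ι Θ Ω : Type*) [MeasurableSpace ι] [MeasurableSpace Θ] [MeasurableSpace Ω]
        (P : MAML.Problem d ι Θ) (L ρ α σ σt σH : ℝ) (s : MAML.BatchSizes) (w₀ : MAML.Vec d)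
        (μ : Measure Ω) [IsProbabilityMeasure μ] (X : ℕ → Ω → MAML.IterDraw ι Θ s) (ε : ℝ),
        0 < L → 0 ≤ ρ → 0 < σ → 0 ≤ σt → 0 ≤ σH →
        P.Assumptions L ρ α σ σt σH →
        ρ * α / L ≤ c₁ → σ ^ 2 + σt ^ 2 ≤ c₂ →
        0 < α → α ≤ 1 / (6 * L) →
        -- the samples of different iterations are independent, each with the law of MAML
        (∀ k, Measurable (X k)) → iIndepFun X μ → (∀ k, μ.map (X k) = P.iterLaw s) →
        -- batch sizes
        1 ≤ s.Din → 1 ≤ s.Do → 1 ≤ s.Dh → 1 ≤ s.B' → 1 ≤ s.Dβ →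
        ⌈2 * α ^ 2 * σH ^ 2⌉₊ ≤ s.Dh → 20 ≤ s.B →
        ⌈0.5 * (ρ * α * σ / L) ^ 2⌉₊ ≤ s.B' → ⌈(2 * ρ * α * σt / L) ^ 2⌉₊ ≤ s.Dβ →
        0 < ε → ε < 1 →
        C₁ * σ ^ 2 / ε ^ 2 ≤ s.B →
        C₂ * σt ^ 2 / ε ^ 2 ≤ s.Din → C₂ * σt ^ 2 / ε ^ 2 ≤ s.B * s.Do →
        ∃ k : ℕ, (k : ℝ) ≤ (P.metaLoss α w₀ - ⨅ w, P.metaLoss α w) * (C * (L / ε ^ 2)) ∧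
          MAML.IsApproxFOSP μ (P.metaLoss α) ε
            (fun ω => P.iterates s L ρ α w₀ (fun j => X j ω) k) := by 
  -- The maxima with 0 keep A ≥ 4 whatever the signs of c₁ and c₂. The value of a bounds σ because
  -- 2σ ≤ 1 + σ².
  set q := max c₁ 0
  set a := 1 + max c₂ 0
  have hq : 0 ≤ q := le_max_right _ _
  have ha : 0 ≤ a := by positivity
  set A := 4 + 4 * q * (1 + a)
  have hA4 : 4 ≤ A := le_add_of_nonneg_right (by positivity)
  have hA0 : 0 < A := by linarith
  -- With 60 A each of the three noise terms is at most ε²/(60 A), a third of the tolerated ε²/(20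
  -- A). The factor 400 A is the reciprocal of the drop ε²/(400 A L) per iteration, up to L/ε².
  refine ⟨60 * A, 60 * A, 400 * A, by positivity, by positivity, by positivity, ?_⟩
  intro d ι Θ Ω _ _ _ P L ρ α σ σt σH s w₀ μ _ X ε hL hρ hσ hσt _ hA hc₁ hc₂ hα hαL hX hind hlaw
    hDin hDo hDh hB' hDβ hDh' hB hB'' hDβ' hε hε1 hBε hDinε hDoε
  have hqa : ρ * α / L ≤ q := hc₁.trans (le_max_left _ _)
  have hσa : σ ≤ a := by
    have : c₂ ≤ max c₂ 0 := le_max_left _ _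
    nlinarith [sq_nonneg σt, sq_nonneg (σ - 1)]
  have hρa : 4 + 4 * (ρ * α / L) * (1 + a) ≤ A := by
    change _ ≤ 4 + 4 * q * (1 + a)
    gcongr
  have small : ∀ x n : ℝ, 0 < n → 60 * A * x / ε ^ 2 ≤ n → x / n ≤ ε ^ 2 / (60 * A) := by
    intro x n hn h
    rw [div_le_iff₀ (by positivity)] at h
    rw [div_le_div_iff₀ hn (by positivity)]
    linarith
  have hB0 : (0 : ℝ) < s.B := by
    have : 0 < s.B := by omega
    exact_mod_cast this
  have hN : σ ^ 2 / s.B + σt ^ 2 / s.Din + σt ^ 2 / (s.B * s.Do) ≤ ε ^ 2 / (20 * A) := by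
    have e1 := small _ _ hB0 hBε
    have e2 := small _ _ (by positivity) hDinε
    have e3 := small _ _ (by positivity) hDoε
    have e4 : ε ^ 2 / (20 * A) = 3 * (ε ^ 2 / (60 * A)) := by field_simp; norm_num
    linarith
  have hdrift := fun w => hA.integral_metaLoss_step_le_linear hL hα hαL hρ hσ.le hσt w hDin hDo hDh
    hB' hDβ ((Nat.le_ceil _).trans (by exact_mod_cast hDh')) hB
    ((Nat.le_ceil _).trans (by exact_mod_cast hB''))
    ((Nat.le_ceil _).trans (by exact_mod_cast hDβ')) ha hε hε1.le hA4 hσa hρa hN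
  have hstep : Measurable (Function.uncurry (P.step s L ρ α)) :=
    hA.measurable_step measurable_fst measurable_snd
  set m := ⨅ u, P.metaLoss α u
  -- The potential is the objective minus its infimum, so its initial value is Δ. At E‖G‖ = ε the
  -- slope gains 3ε² against the noise 2ε², in units of 1/(400 A L), which leaves δ.
  obtain ⟨k, hk, hmeas, hint, hle⟩ := MAML.exists_integral_le_of_drift (μ := μ)
    (ν := P.iterLaw s) hstep (Φ := fun w => P.metaLoss α w - m) (ξ := fun w => ‖P.metaGrad α w‖)
    (a := 3 * ε / (400 * A * L)) (b := 2 * ε ^ 2 / (400 * A * L)) (ε := ε)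
    (δ := ε ^ 2 / (400 * A * L))
    ((hA.continuous_metaLoss hL hα hαL).measurable.sub_const m)
    (hA.continuous_metaGrad hL hα hαL).norm.measurable
    (fun w => sub_nonneg.2 (ciInf_le hA.bddBelow w)) (fun w => norm_nonneg _)
    (by positivity) (by positivity) (by ring)
    (fun w => ⟨(hdrift w).1.sub (integrable_const m), by
      rw [integral_sub (hdrift w).1 (integrable_const m)]
      simp only [integral_const, probReal_univ, one_smul]
      linarith [(hdrift w).2]⟩) hX hind hlaw (w₀ := w₀)
    (W := P.iterates s L ρ α w₀) (fun _ => rfl) (fun _ _ => rfl)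
  refine ⟨k, hk.trans (le_of_eq ?_), ?_, hmeas.aemeasurable, ?_, ?_⟩
  · field_simp
  · exact fun w => (hA.hasGradientAt_metaLoss hL hα hαL w).hasFDerivAt.differentiableAt
  · simpa only [hA.gradient_metaLoss hL hα hαL] using hint
  · simpa only [hA.gradient_metaLoss hL hα hαL] using hle
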